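/- Let $(p_j)_{j\ge1}$ be a probability mass function on $\mathbb N_+=\{1,2,\dots\}$ and let $U_1,U_2,\dots$ be i.i.d. random variables with $\mathbb P(U_i=j)=p_j$. For each integer $n\ge1$ let $N(n)$ be a Poisson random variable with mean $n$, independent of $(U_i)_{i\ge1}$. Put $X_{n,j}=\sum_{i=1}^{n}\mathbb 1\{U_i=j\}$ and $X_j(n)=\sum_{i=1}^{N(n)}\mathbb 1\{U_i=j\}$. The missing mass is $M_{n,0}=\sum_{j\ge1}p_j\,\mathbb 1\{X_{n,j}=0\}$ in the binomial setting and $M_0(n)=\sum_{j\ge1}p_j\,\mathbb 1\{X_j(n)=0\}$ in the Poisson setting. Let $K_2(n)=|\{j: X_j(n)=2\}|$, $K_{\overline 2}(n)=|\{j: X_j(n)\ge2\}|$, and $$v_n^-=\frac{2\,\mathbb E K_2(n)}{n^2},\qquad v_n^+=\frac{2\,\mathbb E K_{\overline 2}(n)}{n^2}.$$ Let $\vec\nu(x)=|\{j\ge1: p_j\ge x\}|$ for $x>0$, and assume that $\vec\nu(1/\cdot)$ is regularly varying at infinity with index $\alpha\in(0,1]$: there is a function $\ell$ such that $\ell(\tau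 x)/\ell(\tau)\to1$ as $\tau\to\infty$ for every $x>0$, and $\vec\nu(1/x)\sim x^\alpha\ell(x)$ as $x\to\infty$. Then for each $n\ge1$, both for $M=M_{n,0}$ and for $M=M_0(n)$: - $M$ is sub-Gaussian on the left tail with variance factor $v_n^-$, that is, for all $\lambda\le0$, $$\log\mathbb E\, e^{\lambda(M-\mathbb E M)}\le \frac{v_n^-\lambda^2}{2};$$ - $M$ is sub-gamma on the right tail with variance factor $v_n^+$ and scale parameter $1/n$, that is, for all $0\le\lambda<n$, $$\log\mathbb E\, e^{\lambda(M-\mathbb E M)}\le \frac{v_n^+\lambda^2}{2(1-\lambda/n)}.$$ Moreover, as $n\to\infty$, $$\frac{v_n^-}{\operatorname{Var}(M_{n,0})}\to\frac1{1-2^{\alpha-2}},\qquad \frac{v_n^+}{\operatorname{Var}(M_{n,0})}\to\frac{2}{\alpha(1-2^{\alpha-2})},$$ the same two limits hold with $\operatorname{Var}(M_0(n))$ in place of $\operatorname{Var}(M_{n,0})$, and $$\frac{v_n^-}{v_n^+}\to\frac{\alpha}{2}.$$ -/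

import Mathlib

open MeasureTheory ProbabilityTheory Filter Topology
open scoped NNReal

noncomputable section

namespace UrnScheme

/-- The set of symbols carries the discrete σ-algebra. -/
instance instMeasurableSpaceSymbol : MeasurableSpace ℕ+ := ⊤

instance instDiscreteMeasurableSpaceSymbol : DiscreteMeasurableSpace ℕ+ :=
  ⟨fun _ => trivial⟩

/-! ### Regular variation -/

/-- `ℓ` is slowly varying at infinity: `ℓ (τ x) / ℓ τ → 1` as `τ → ∞`, for every `x > 0`. -/
def SlowlyVarying (ℓ : ℝ → ℝ) : Prop :=
  ∀ x : ℝ, 0 < x → Tendsto (fun τ : ℝ => ℓ (τ * x) / ℓ τ) atTop (𝓝 1)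

/-- `f` is regularly varying at infinity with index `α`: `f x ∼ x ^ α * ℓ x` as `x → ∞`,
for some slowly varying function `ℓ`. -/
def RegularlyVarying (f : ℝ → ℝ) (α : ℝ) : Prop :=
  ∃ ℓ : ℝ → ℝ, SlowlyVarying ℓ ∧
    Asymptotics.IsEquivalent atTop f (fun x : ℝ => x ^ α * ℓ x)

/-- The counting function `x ↦ |{j ≥ 1 : p j ≥ x}|`. It is only used at `x > 0`, where the set
is finite. -/
def countingFunction (p : PMF ℕ+) (x : ℝ) : ℝ :=
  (Set.ncard {j : ℕ+ | x ≤ (p j).toReal} : ℝ)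

/-! ### Occupancy quantities

The symbols drawn are `U 0, U 1, …`, and the sample consists of the first `T ω` of them. The sample
size `T` may be random: a constant `n` gives the binomial setting, and a Poisson variable
independent of the draws gives the Poisson setting. -/

section Occupancy

variable {Ω : Type*}

/-- The number of occurrences of the symbol `j` in the sample of size `T`. -/
def symbolCount (U : ℕ → Ω → ℕ+) (T : Ω → ℕ) (j : ℕ+) (ω : Ω) : ℕ :=
  ((Finset.range (T ω)).filter (fun i => U i ω = j)).card

/-- The number of symbols that occur exactly `r` times (a finite number for `r ≥ 1`). -/
def occupancyCount (U : ℕ → Ω → ℕ+) (T : Ω → ℕ) (r : ℕ) (ω : Ω) : ℝ :=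
  (Set.ncard {j : ℕ+ | symbolCount U T j ω = r} : ℝ)

/-- The number of symbols that occur at least `r` times (a finite number for `r ≥ 1`). -/
def cumulatedOccupancyCount (U : ℕ → Ω → ℕ+) (T : Ω → ℕ) (r : ℕ) (ω : Ω) : ℝ :=
  (Set.ncard {j : ℕ+ | r ≤ symbolCount U T j ω} : ℝ)

/-- The missing mass: the total probability of the symbols that do not occur in the sample. -/
def missingMass (p : PMF ℕ+) (U : ℕ → Ω → ℕ+) (T : Ω → ℕ) (ω : Ω) : ℝ :=
  ∑' j : ℕ+, if symbolCount U T j ω = 0 then (p j).toReal else 0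

variable [MeasurableSpace Ω]

/-- `v_n^- = 2 𝔼[K_2(n)] / n²`, where `K_2(n)` is the number of symbols occurring exactly twice in
the Poisson sample of random size `N n`. -/
def varianceFactorLeft (μ : Measure Ω) (U : ℕ → Ω → ℕ+) (N : ℕ → Ω → ℕ) (n : ℕ) : ℝ :=
  2 * (∫ ω, occupancyCount U (N n) 2 ω ∂μ) / (n : ℝ) ^ 2

/-- `v_n^+ = 2 𝔼[K_{≥2}(n)] / n²`, where `K_{≥2}(n)` is the number of symbols occurring at least
twice in the Poisson sample of random size `N n`. -/
def varianceFactorRight (μ : Measure Ω) (U : ℕ → Ω → ℕ+) (N : ℕ → Ω → ℕ) (n : ℕ) : ℝ :=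
  2 * (∫ ω, cumulatedOccupancyCount U (N n) 2 ω ∂μ) / (n : ℝ) ^ 2

/-! ### Bounds on the log-Laplace transform -/

/-- `Z` is sub-Gaussian on the left tail with variance factor `v`. -/
def SubGaussianLeft (Z : Ω → ℝ) (v : ℝ) (μ : Measure Ω) : Prop :=
  Integrable Z μ ∧ ∀ s : ℝ, s ≤ 0 →
    Integrable (fun ω => Real.exp (s * (Z ω - ∫ ω', Z ω' ∂μ))) μ ∧
    Real.log (∫ ω, Real.exp (s * (Z ω - ∫ ω', Z ω' ∂μ)) ∂μ) ≤ v * s ^ 2 / 2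

/-- `Z` is sub-gamma on the right tail with variance factor `v` and scale parameter `c > 0`.
At the endpoint `s = 1 / c` the usual bound reads `≤ +∞`, so that it says nothing. -/
def SubGammaRight (Z : Ω → ℝ) (v c : ℝ) (μ : Measure Ω) : Prop :=
  Integrable Z μ ∧ ∀ s : ℝ, 0 ≤ s → s < 1 / c →
    Integrable (fun ω => Real.exp (s * (Z ω - ∫ ω', Z ω' ∂μ))) μ ∧
    Real.log (∫ ω, Real.exp (s * (Z ω - ∫ ω', Z ω' ∂μ)) ∂μ) ≤ s ^ 2 * v / (2 * (1 - c * s))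

end Occupancy

end UrnScheme

end

namespace UrnScheme

/-! ### Regular variation -/

/-! Write `L t = ∑ p_j² exp (-t p_j)` (`squareLaplace`), `R t = ∑ (1 - exp (-t p_j) (1 + t p_j))`
(`repeatSum`), and `ν` for the counting function. In the Poisson scheme the count of `j` is Poisson
with mean `n p_j`, so the variance factors are `L n` and `2 R n / n²`.

Concentration. The missing mass is `∑ p_j Y_j`, with `Y_j` the indicator that `j` is absent. These
indicators are independent in the Poisson scheme (`IsPoissonSize.integral_unoccupiedProd`). In the
binomial scheme they are negatively dependent, enough so for the Laplace transform to be at most the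
product of the marginal ones (`IsSample.integral_unoccupiedProd_le`). In both schemes `q_j = 𝔼 Y_j ≤
exp (-n p_j)`, so the centred log-Laplace transform is at most `∑ q_j (exp (s p_j) - 1 - s p_j)`.
For `s ≤ 0`, `exp x - 1 - x ≤ x² / 2` turns this into `s² L n / 2`. For `0 ≤ s < n`, comparing power
series gives `exp (s p_j) - 1 - s p_j ≤ (s / n)² (exp (n p_j) - 1 - n p_j)`, and multiplying by `exp
(-n p_j)` produces the terms of `R n`.

Asymptotics. Summation by parts writes `∑ g (t p_j)` as `∫ g' u * ν (u / t) du`; dividing by `ν (1 /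
t)`, regular variation and a Potter bound give the limit `∫ g' u * u ^ (-α) du`
(`tendsto_tsum_comp_toReal_div`). Hence `t² L t / ν (1 / t) → α Γ(2 - α)` and `R t / ν (1 / t) → Γ(2
- α)`, which yields the ratio `α / 2` of the factors and `L (2 t) / L t → 2 ^ (α - 2)`. The Poisson
variance is exactly `L n - L (2 n)`. The binomial variance differs from it by `O(n (L n)² + R n /
n³)` (`abs_variance_sub_variance_le`), which is `o(L n)` because `t L t → 0`. -/

theorem RegularlyVarying.eventually_ne_zero {f : ℝ → ℝ} {α : ℝ} (hf : RegularlyVarying f α) :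
    ∀ᶠ t in atTop, f t ≠ 0 := by
  obtain ⟨ℓ, hℓ, hfl⟩ := hf
  have h1 : ∀ᶠ t in atTop, ℓ t ≠ 0 := by
    -- Division by zero gives `0`, so a quotient close to `1` has a nonzero denominator.
    have := (hℓ 1 one_pos).eventually_ne one_ne_zero
    filter_upwards [this] with t ht h0
    simp [h0] at ht
  have h2 : ∀ᶠ t : ℝ in atTop, t ^ α * ℓ t ≠ 0 := by
    filter_upwards [h1, eventually_gt_atTop 0] with t ht h0
    exact mul_ne_zero (Real.rpow_pos_of_pos h0 α).ne' ht
  have h3 := (Asymptotics.isEquivalent_iff_tendsto_one h2).1 hfl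
  filter_upwards [h3.eventually_ne one_ne_zero] with t ht h0
  simp [h0] at ht

theorem RegularlyVarying.tendsto_ratio {f : ℝ → ℝ} {α : ℝ} (hf : RegularlyVarying f α)
    {x : ℝ} (hx : 0 < x) : Tendsto (fun t => f (t * x) / f t) atTop (𝓝 (x ^ α)) := by
  have hne := hf.eventually_ne_zero
  obtain ⟨ℓ, hℓ, hfl⟩ := hf
  have h1 : ∀ᶠ t in atTop, ℓ t ≠ 0 := by
    have := (hℓ 1 one_pos).eventually_ne one_ne_zero
    filter_upwards [this] with t ht h0
    simp [h0] at ht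
  have hx' : Tendsto (fun t : ℝ => t * x) atTop atTop := tendsto_id.atTop_mul_const hx
  have h := (hfl.comp_tendsto hx').div hfl
  refine h.symm.tendsto_nhds ?_
  have h2 : Tendsto (fun t : ℝ => x ^ α * (ℓ (t * x) / ℓ t)) atTop (𝓝 (x ^ α * 1)) :=
    (hℓ x hx).const_mul _
  rw [mul_one] at h2
  refine h2.congr' ?_
  filter_upwards [h1, eventually_gt_atTop 0] with t ht h0
  have h3 := (Real.rpow_pos_of_pos h0 α).ne'
  simp only [Function.comp, Pi.div_apply]
  rw [Real.mul_rpow h0.le hx.le]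
  field_simp

/-- A Potter-type bound for monotone functions of regular variation with index at most one. -/
theorem RegularlyVarying.exists_le_rpow_mul {f : ℝ → ℝ} {α : ℝ} (hf : RegularlyVarying f α)
    (hα : α ≤ 1) (hmono : MonotoneOn f (Set.Ioi 0)) (hnonneg : ∀ t, 0 ≤ f t) :
    ∀ᶠ t in atTop, ∀ y, 1 ≤ y → f (t * y) ≤ 4 * y ^ (3 / 2 : ℝ) * f t := by
  -- The exponent `3 / 2` exceeds `α ≤ 1`, which gives the doubling inequality, and is below `2`,
  -- which keeps `u * u ^ (-3 / 2)` integrable at `0` when the bound serves for domination.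
  have h1 : (2 : ℝ) ^ α < 2 ^ (3 / 2 : ℝ) :=
    Real.rpow_lt_rpow_of_exponent_lt (by norm_num) (by linarith)
  have h2 := (hf.tendsto_ratio (x := 2) two_pos).eventually_le_const h1
  obtain ⟨t₀, ht₀⟩ := eventually_atTop.1 (h2.and hf.eventually_ne_zero)
  have hdouble : ∀ t, t₀ ≤ t → f (t * 2) ≤ 2 ^ (3 / 2 : ℝ) * f t := by
    intro t ht
    obtain ⟨ha, hb⟩ := ht₀ t ht
    rwa [div_le_iff₀ (lt_of_le_of_ne (hnonneg t) hb.symm)] at ha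
  have hiter : ∀ (k : ℕ) t, 0 < t → t₀ ≤ t → f (t * 2 ^ k) ≤ ((2 : ℝ) ^ (3 / 2 : ℝ)) ^ k * f t := by
    intro k
    induction k with
    | zero => intro t _ _; simp
    | succ k ih =>
      intro t h0 ht
      have h3 : t ≤ t * 2 ^ k := le_mul_of_one_le_right h0.le (one_le_pow₀ (by norm_num))
      calc f (t * 2 ^ (k + 1)) = f (t * 2 ^ k * 2) := by ring_nf
        _ ≤ 2 ^ (3 / 2 : ℝ) * f (t * 2 ^ k) := hdouble _ (ht.trans h3)
        _ ≤ 2 ^ (3 / 2 : ℝ) * (((2 : ℝ) ^ (3 / 2 : ℝ)) ^ k * f t) := by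
            gcongr; exact ih t h0 ht
        _ = _ := by ring
  filter_upwards [eventually_ge_atTop t₀, eventually_gt_atTop 0] with t ht h0 y hy
  obtain ⟨k, hk1, hk2⟩ := exists_nat_pow_near hy (one_lt_two)
  have hy0 : 0 < y := by linarith
  calc f (t * y) ≤ f (t * 2 ^ (k + 1)) := by
        apply hmono (Set.mem_Ioi.2 (by positivity)) (Set.mem_Ioi.2 (by positivity))
        gcongr
    _ ≤ ((2 : ℝ) ^ (3 / 2 : ℝ)) ^ (k + 1) * f t := hiter _ _ h0 ht
    _ = (2 : ℝ) ^ (3 / 2 : ℝ) * ((2 : ℝ) ^ k) ^ (3 / 2 : ℝ) * f t := by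
        rw [← Real.rpow_natCast, ← Real.rpow_mul (by norm_num), ← Real.rpow_natCast 2 k,
          ← Real.rpow_mul (by norm_num), ← Real.rpow_add (by norm_num)]
        congr 2; push_cast; ring
    _ ≤ 4 * y ^ (3 / 2 : ℝ) * f t := by
        have : (2 : ℝ) ^ (3 / 2 : ℝ) ≤ 4 := by
          calc (2 : ℝ) ^ (3 / 2 : ℝ) ≤ 2 ^ (2 : ℝ) :=
                Real.rpow_le_rpow_of_exponent_le (by norm_num) (by norm_num)
            _ = 4 := by norm_num
        gcongr
        exact hnonneg t

/-! ### The counting function -/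

theorem summable_toReal (p : PMF ℕ+) : Summable fun j => (p j).toReal :=
  ENNReal.summable_toReal p.tsum_coe_ne_top

theorem tsum_toReal (p : PMF ℕ+) : ∑' j, (p j).toReal = 1 := by
  rw [← ENNReal.tsum_toReal_eq fun j => p.apply_ne_top j, p.tsum_coe, ENNReal.toReal_one]

theorem toReal_le_one (p : PMF ℕ+) (j : ℕ+) : (p j).toReal ≤ 1 :=
  ENNReal.toReal_le_of_le_ofReal one_pos.le (by simpa using p.coe_le_one j)

theorem summable_toReal_sq (p : PMF ℕ+) : Summable fun j => (p j).toReal ^ 2 :=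
  (summable_toReal p).of_nonneg_of_le (fun _ => by positivity) fun j => by
    have := toReal_le_one p j
    have h0 : 0 ≤ (p j).toReal := ENNReal.toReal_nonneg
    nlinarith

theorem finite_setOf_le_toReal (p : PMF ℕ+) {x : ℝ} (hx : 0 < x) :
    {j : ℕ+ | x ≤ (p j).toReal}.Finite := by
  have := (summable_toReal p).tendsto_cofinite_zero.eventually_lt_const hx
  simpa [Filter.eventually_cofinite, not_lt] using this

theorem countingFunction_antitoneOn (p : PMF ℕ+) :
    AntitoneOn (countingFunction p) (Set.Ioi 0) := by
  intro x hx y hy hxy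
  exact Nat.cast_le.2 (Set.ncard_le_ncard (fun j hj => hxy.trans hj) (finite_setOf_le_toReal p hx))

theorem countingFunction_nonneg (p : PMF ℕ+) (x : ℝ) : 0 ≤ countingFunction p x :=
  Nat.cast_nonneg _

theorem tsum_ite_le_toReal (p : PMF ℕ+) {x : ℝ} (hx : 0 < x) (c : ℝ) :
    ∑' j : ℕ+, (if x ≤ (p j).toReal then c else 0) = c * countingFunction p x := by
  classical
  have hfin := finite_setOf_le_toReal p hx
  rw [countingFunction, Set.ncard_eq_toFinset_card _ hfin, tsum_eq_sum (s := hfin.toFinset)]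
  · rw [Finset.sum_congr rfl (g := fun _ => c)]
    · simp [mul_comm]
    · intro j hj
      rw [if_pos (by simpa using hj)]
  · intro j hj
    rw [if_neg (by simpa using hj)]

/-- Summation by parts: a sum over the symbols is an integral against the counting function. -/
theorem hasSum_comp_toReal (p : PMF ℕ+) {g g' : ℝ → ℝ} (hg : ∀ u, HasDerivAt g (g' u) u)
    (hg0 : g 0 = 0) (hg' : Continuous g') {C : ℝ} (hC : ∀ u, 0 ≤ u → |g' u| ≤ C * u)
    {t : ℝ} (ht : 0 < t) :
    HasSum (fun j => g (t * (p j).toReal))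
      (∫ u in Set.Ioi 0, g' u * countingFunction p (u / t)) := by
  have ha0 : ∀ j, 0 ≤ t * (p j).toReal := fun j => by positivity
  have hC0 : 0 ≤ C := by simpa using (abs_nonneg _).trans (hC 1 zero_le_one)
  -- `g (t p_j)` is the integral of `g'` over `(0, t p_j]`. The `L¹` norms are at most `C t² p_j²`,
  -- which is summable, so sum and integral may be exchanged.
  let F : ℕ+ → ℝ → ℝ := fun j => (Set.Iic (t * (p j).toReal)).indicator g'
  have hres : ∀ j, (volume.restrict (Set.Ioi (0 : ℝ))).restrict (Set.Iic (t * (p j).toReal))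
      = volume.restrict (Set.Ioc 0 (t * (p j).toReal)) := by
    intro j
    rw [Measure.restrict_restrict measurableSet_Iic, Set.inter_comm, Set.Ioi_inter_Iic]
  have hint : ∀ j, Integrable (F j) (volume.restrict (Set.Ioi 0)) := by
    intro j
    rw [integrable_indicator_iff measurableSet_Iic, IntegrableOn, hres]
    exact (hg'.integrableOn_Icc).mono_set Set.Ioc_subset_Icc_self
  have hval : ∀ j, ∫ u in Set.Ioi 0, F j u = g (t * (p j).toReal) := by
    intro j
    rw [integral_indicator measurableSet_Iic, hres, ← intervalIntegral.integral_of_le (ha0 j),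
      intervalIntegral.integral_eq_sub_of_hasDerivAt (fun u _ => hg u)
        (hg'.intervalIntegrable _ _), hg0, sub_zero]
  have hnorm : ∀ j, ∫ u in Set.Ioi 0, ‖F j u‖ ≤ C * t ^ 2 * (p j).toReal ^ 2 := by
    intro j
    have : ∀ u, ‖F j u‖ = (Set.Iic (t * (p j).toReal)).indicator (fun u => ‖g' u‖) u := fun u =>
      norm_indicator_eq_indicator_norm _ _
    simp_rw [this]
    rw [integral_indicator measurableSet_Iic, hres]
    have h := norm_setIntegral_le_of_norm_le_const (μ := volume)
      (s := Set.Ioc 0 (t * (p j).toReal))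
      (f := fun u => ‖g' u‖) (C := C * (t * (p j).toReal)) (by simp) (fun u hu => by
        rw [norm_norm]
        exact (hC u hu.1.le).trans (by gcongr; exact hu.2))
    refine (Real.le_norm_self _).trans (h.trans_eq ?_)
    simp [Measure.real, ha0 j]
    ring
  have hsum := hasSum_integral_of_summable_integral_norm hint
    (((summable_toReal_sq p).mul_left (C * t ^ 2)).of_nonneg_of_le
      (fun j => integral_nonneg fun u => norm_nonneg _) hnorm)
  simp_rw [hval] at hsum
  have heq : ∫ u in Set.Ioi 0, g' u * countingFunction p (u / t)
      = ∫ u in Set.Ioi 0, ∑' j, F j u := by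
    refine setIntegral_congr_fun measurableSet_Ioi fun u hu => ?_
    have hu' : 0 < u / t := div_pos hu ht
    rw [← tsum_ite_le_toReal p hu']
    refine tsum_congr fun j => ?_
    simp only [F, Set.indicator, Set.mem_Iic, div_le_iff₀' ht]
  rwa [heq]

end UrnScheme

namespace UrnScheme

/-! ### Abelian asymptotics of sums over the symbols -/

theorem monotoneOn_countingFunction_one_div (p : PMF ℕ+) :
    MonotoneOn (fun x : ℝ => countingFunction p (1 / x)) (Set.Ioi 0) := by
  intro x hx y hy hxy
  exact countingFunction_antitoneOn p (Set.mem_Ioi.2 (one_div_pos.2 hy))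
    (Set.mem_Ioi.2 (one_div_pos.2 hx)) (one_div_le_one_div_of_le hx hxy)

theorem integrableOn_rpow_mul_exp_neg_half {s : ℝ} (hs : -1 < s) :
    IntegrableOn (fun u : ℝ => u ^ s * Real.exp (-(1 / 2) * u)) (Set.Ioi 0) := by
  simpa using integrableOn_rpow_mul_exp_neg_mul_rpow (p := 1) (s := s) hs one_pos
    (b := 1 / 2) (by norm_num)

/-- After summation by parts the integrand is `g' u * (ν (u / t) / ν (1 / t))`, which converges
pointwise to `g' u * u ^ (-α)`. For domination, the ratio is at most `1` when `u ≥ 1` by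
monotonicity, and at most `4 u ^ (-3 / 2)` when `u ≤ 1` by the Potter bound. The factor `u` in the
bound on `g'` makes the latter integrable at `0`. -/
theorem tendsto_tsum_comp_toReal_div (p : PMF ℕ+) {α : ℝ} (hα1 : α ≤ 1)
    (hreg : RegularlyVarying (fun x : ℝ => countingFunction p (1 / x)) α)
    {g g' : ℝ → ℝ} (hg : ∀ u, HasDerivAt g (g' u) u)
    (hg0 : g 0 = 0) (hg' : Continuous g') {C : ℝ}
    (hC : ∀ u, 0 ≤ u → |g' u| ≤ C * (u * Real.exp (-(1 / 2) * u))) :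
    Tendsto (fun t : ℝ => (∑' j, g (t * (p j).toReal)) / countingFunction p (1 / t)) atTop
      (𝓝 (∫ u in Set.Ioi 0, g' u * u ^ (-α))) := by
  have hC0 : 0 ≤ C := by
    have := (abs_nonneg _).trans (hC 1 zero_le_one)
    rw [one_mul] at this
    exact nonneg_of_mul_nonneg_left this (Real.exp_pos _)
  have hC' : ∀ u, 0 ≤ u → |g' u| ≤ C * u := fun u hu => (hC u hu).trans <| by
    gcongr
    exact mul_le_of_le_one_right hu (Real.exp_le_one_iff.2 (by linarith))
  have key : Tendsto (fun t : ℝ => ∫ u in Set.Ioi 0,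
      g' u * (countingFunction p (u / t) / countingFunction p (1 / t))) atTop
      (𝓝 (∫ u in Set.Ioi 0, g' u * u ^ (-α))) := by
    refine tendsto_integral_filter_of_dominated_convergence
      (fun u => 4 * C * (u ^ (1 : ℝ) * Real.exp (-(1 / 2) * u)) +
        4 * C * (u ^ (-1 / 2 : ℝ) * Real.exp (-(1 / 2) * u))) ?_ ?_ ?_ ?_
    · filter_upwards [eventually_gt_atTop 0] with t ht
      refine hg'.aestronglyMeasurable.mul (AEMeasurable.aestronglyMeasurable ?_)
      refine AEMeasurable.div_const ?_ _
      refine aemeasurable_restrict_of_antitoneOn measurableSet_Ioi ?_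
      intro x hx y hy hxy
      exact countingFunction_antitoneOn p (Set.mem_Ioi.2 (div_pos hx ht))
        (Set.mem_Ioi.2 (div_pos hy ht)) (by gcongr)
    · filter_upwards [eventually_gt_atTop 0, hreg.eventually_ne_zero,
        hreg.exists_le_rpow_mul hα1 (monotoneOn_countingFunction_one_div p)
          (fun t => countingFunction_nonneg p _)] with t ht hne hpot
      refine (ae_restrict_iff' measurableSet_Ioi).2 (ae_of_all _ fun u hu => ?_)
      have hu0 : (0 : ℝ) < u := hu
      have hpos : 0 < countingFunction p (1 / t) :=
        lt_of_le_of_ne (countingFunction_nonneg p _) (Ne.symm hne)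
      have hratio : countingFunction p (u / t) / countingFunction p (1 / t)
          ≤ 4 * (1 + u ^ (-(3 / 2) : ℝ)) := by
        rw [div_le_iff₀ hpos]
        have h32 : 0 < u ^ (-(3 / 2) : ℝ) := Real.rpow_pos_of_pos hu0 _
        rcases le_total 1 u with h1 | h1
        · have := countingFunction_antitoneOn p (Set.mem_Ioi.2 (one_div_pos.2 ht))
            (Set.mem_Ioi.2 (div_pos hu0 ht)) (by gcongr)
          nlinarith
        · have := hpot u⁻¹ ((one_le_inv₀ hu0).2 h1)
          rw [Real.inv_rpow hu0.le, ← Real.rpow_neg hu0.le] at this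
          have he : 1 / (t * u⁻¹) = u / t := by field_simp
          simp only [he] at this
          nlinarith
      rw [norm_mul, Real.norm_eq_abs, Real.norm_of_nonneg
        (div_nonneg (countingFunction_nonneg p _) hpos.le)]
      calc |g' u| * (countingFunction p (u / t) / countingFunction p (1 / t))
          ≤ (C * (u * Real.exp (-(1 / 2) * u))) * (4 * (1 + u ^ (-(3 / 2) : ℝ))) := by
            gcongr
            · exact div_nonneg (countingFunction_nonneg p _) hpos.le
            · exact hC u hu0.le
        _ = _ := by
            have : u ^ (-1 / 2 : ℝ) = u * u ^ (-(3 / 2) : ℝ) := by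
              rw [← Real.rpow_one_add' hu0.le (by norm_num)]; norm_num
            rw [this, Real.rpow_one]; ring
    · exact ((integrableOn_rpow_mul_exp_neg_half (by norm_num)).const_mul _).add
        ((integrableOn_rpow_mul_exp_neg_half (by norm_num)).const_mul _)
    · refine (ae_restrict_iff' measurableSet_Ioi).2 (ae_of_all _ fun u hu => ?_)
      have hu0 : (0 : ℝ) < u := hu
      have h := hreg.tendsto_ratio (x := u⁻¹) (inv_pos.2 hu0)
      rw [Real.inv_rpow hu0.le, ← Real.rpow_neg hu0.le] at h
      refine (h.congr fun t => ?_).const_mul _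
      rw [one_div (t * u⁻¹), mul_inv, inv_inv, mul_comm, ← div_eq_mul_inv]
  refine key.congr' ?_
  filter_upwards [eventually_gt_atTop 0] with t ht
  rw [(hasSum_comp_toReal p hg hg0 hg' hC' ht).tsum_eq, ← integral_div]
  simp_rw [mul_div_assoc]

theorem integral_mul_exp_neg_mul_rpow {α : ℝ} (hα1 : α ≤ 1) :
    ∫ u in Set.Ioi (0 : ℝ), u * Real.exp (-u) * u ^ (-α) = Real.Gamma (2 - α) := by
  rw [Real.Gamma_eq_integral (by linarith)]
  refine setIntegral_congr_fun measurableSet_Ioi fun u hu => ?_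
  have hu0 : (0 : ℝ) < u := hu
  rw [show 2 - α - 1 = 1 + -α by ring, Real.rpow_add hu0, Real.rpow_one]
  ring

theorem integral_deriv_sq_mul_exp_neg_mul_rpow {α : ℝ} (hα1 : α ≤ 1) :
    ∫ u in Set.Ioi (0 : ℝ), (2 * u - u ^ 2) * Real.exp (-u) * u ^ (-α)
      = α * Real.Gamma (2 - α) := by
  have h1 := Real.GammaIntegral_convergent (s := 2 - α) (by linarith)
  have h2 := Real.GammaIntegral_convergent (s := 3 - α) (by linarith)
  have h3 : Real.Gamma (3 - α) = (2 - α) * Real.Gamma (2 - α) := by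
    rw [← Real.Gamma_add_one (by linarith)]; ring_nf
  calc ∫ u in Set.Ioi (0 : ℝ), (2 * u - u ^ 2) * Real.exp (-u) * u ^ (-α)
      = ∫ u in Set.Ioi (0 : ℝ), (2 * (Real.exp (-u) * u ^ (2 - α - 1))
          - Real.exp (-u) * u ^ (3 - α - 1)) := by
        refine setIntegral_congr_fun measurableSet_Ioi fun u hu => ?_
        have hu0 : (0 : ℝ) < u := hu
        rw [show 2 - α - 1 = 1 + -α by ring, show 3 - α - 1 = 2 + -α by ring,
          Real.rpow_add hu0, Real.rpow_add hu0, Real.rpow_one, Real.rpow_two]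
        ring
    _ = 2 * Real.Gamma (2 - α) - Real.Gamma (3 - α) := by
        rw [integral_sub (h1.const_mul 2) h2, integral_const_mul,
          Real.Gamma_eq_integral (by linarith), Real.Gamma_eq_integral (by linarith)]
    _ = _ := by rw [h3]; ring

/-- The sum `∑ p_j² exp (-t p_j)`, which is the left variance factor at time `t`. -/
noncomputable def squareLaplace (p : PMF ℕ+) (t : ℝ) : ℝ :=
  ∑' j, (p j).toReal ^ 2 * Real.exp (-(t * (p j).toReal))

/-- The expected number of symbols occurring at least twice at time `t` of the Poisson scheme. -/
noncomputable def repeatSum (p : PMF ℕ+) (t : ℝ) : ℝ :=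
  ∑' j, (1 - Real.exp (-(t * (p j).toReal)) * (1 + t * (p j).toReal))

theorem summable_squareLaplace (p : PMF ℕ+) {t : ℝ} (ht : 0 ≤ t) :
    Summable fun j => (p j).toReal ^ 2 * Real.exp (-(t * (p j).toReal)) :=
  (summable_toReal_sq p).of_nonneg_of_le (fun _ => by positivity) fun j =>
    mul_le_of_le_one_right (by positivity) (Real.exp_le_one_iff.2 (by
      have : 0 ≤ t * (p j).toReal := by positivity
      linarith))

theorem tendsto_sq_mul_squareLaplace_div (p : PMF ℕ+) {α : ℝ} (hα1 : α ≤ 1)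
    (hreg : RegularlyVarying (fun x : ℝ => countingFunction p (1 / x)) α) :
    Tendsto (fun t : ℝ => t ^ 2 * squareLaplace p t / countingFunction p (1 / t)) atTop
      (𝓝 (α * Real.Gamma (2 - α))) := by
  rw [← integral_deriv_sq_mul_exp_neg_mul_rpow hα1]
  refine (tendsto_tsum_comp_toReal_div p hα1 hreg (g := fun u => u ^ 2 * Real.exp (-u))
    (C := 4) (fun u => ?_) (by simp) (by fun_prop) ?_).congr fun t => ?_
  · exact (((hasDerivAt_id u).pow 2).mul (hasDerivAt_neg u).exp).congr_deriv (by simp; ring)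
  · intro u hu
    -- One half of the exponential absorbs the polynomial factor `2 + u`; the other half remains in
    -- the bound.
    have h1 : Real.exp (-u) = Real.exp (-(1 / 2) * u) * Real.exp (-(1 / 2) * u) := by
      rw [← Real.exp_add]; ring_nf
    have h2 : (2 + u) * Real.exp (-(1 / 2) * u) ≤ 4 := by
      have := Real.add_one_le_exp ((1 / 2) * u)
      rw [neg_mul, Real.exp_neg, ← div_eq_mul_inv, div_le_iff₀ (Real.exp_pos _)]
      linarith
    have h3 : |2 * u - u ^ 2| ≤ u * (2 + u) := by
      rw [abs_le]; constructor <;> nlinarith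
    rw [abs_mul, Real.abs_exp, h1]
    calc |2 * u - u ^ 2| * (Real.exp (-(1 / 2) * u) * Real.exp (-(1 / 2) * u))
        ≤ u * (2 + u) * (Real.exp (-(1 / 2) * u) * Real.exp (-(1 / 2) * u)) := by gcongr
      _ = ((2 + u) * Real.exp (-(1 / 2) * u)) * (u * Real.exp (-(1 / 2) * u)) := by ring
      _ ≤ _ := by gcongr
  · rw [squareLaplace, ← tsum_mul_left]
    congr 2
    ext j
    ring

theorem tendsto_repeatSum_div (p : PMF ℕ+) {α : ℝ} (hα1 : α ≤ 1)
    (hreg : RegularlyVarying (fun x : ℝ => countingFunction p (1 / x)) α) :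
    Tendsto (fun t : ℝ => repeatSum p t / countingFunction p (1 / t)) atTop
      (𝓝 (Real.Gamma (2 - α))) := by
  rw [← integral_mul_exp_neg_mul_rpow hα1]
  refine tendsto_tsum_comp_toReal_div p hα1 hreg
    (g := fun u => 1 - Real.exp (-u) * (1 + u))
    (C := 1) (fun u => ?_) (by simp) (by fun_prop) ?_
  · exact (((hasDerivAt_neg u).exp.mul ((hasDerivAt_id u).const_add 1)).const_sub 1).congr_deriv
      (by simp; ring)
  · intro u hu
    rw [abs_of_nonneg (by positivity), one_mul]
    gcongr
    linarith

theorem squareLaplace_pos (p : PMF ℕ+) {t : ℝ} (ht : 0 ≤ t) : 0 < squareLaplace p t := by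
  obtain ⟨j, hj⟩ := p.support_nonempty
  have hj' : 0 < (p j).toReal := ENNReal.toReal_pos hj (p.apply_ne_top j)
  exact (summable_squareLaplace p ht).tsum_pos (fun _ => by positivity) j (by positivity)

/-- Since `t² L t` is asymptotic to a constant times `ν (1 / t)`, doubling `t` multiplies `L` by `2
^ α / 4` in the limit. -/
theorem tendsto_squareLaplace_two_mul_div (p : PMF ℕ+) {α : ℝ} (hα0 : 0 < α) (hα1 : α ≤ 1)
    (hreg : RegularlyVarying (fun x : ℝ => countingFunction p (1 / x)) α) :
    Tendsto (fun t : ℝ => squareLaplace p (2 * t) / squareLaplace p t) atTop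
      (𝓝 ((2 : ℝ) ^ (α - 2))) := by
  have hG : 0 < Real.Gamma (2 - α) := Real.Gamma_pos_of_pos (by linarith)
  have h1 := tendsto_sq_mul_squareLaplace_div p hα1 hreg
  have h2 := h1.comp (tendsto_id.const_mul_atTop (two_pos (α := ℝ)))
  have h3 := hreg.tendsto_ratio (x := 2) two_pos
  have h4 := ((h2.div h1 (by positivity)).mul h3).div_const 4
  rw [div_self (by positivity), one_mul] at h4
  have : (2 : ℝ) ^ (α - 2) = 2 ^ α / 4 := by
    rw [Real.rpow_sub two_pos]; norm_num
  rw [this]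
  refine h4.congr' ?_
  have h5 := (tendsto_id.const_mul_atTop (two_pos (α := ℝ))).eventually hreg.eventually_ne_zero
  filter_upwards [eventually_gt_atTop 0, hreg.eventually_ne_zero, h5] with t ht hne hne2
  have := (squareLaplace_pos p ht.le).ne'
  simp only [Function.comp, id, Pi.div_apply] at *
  rw [mul_comm t 2]
  field_simp
  ring

theorem tendsto_squareLaplace_div_repeatSum (p : PMF ℕ+) {α : ℝ} (hα1 : α ≤ 1)
    (hreg : RegularlyVarying (fun x : ℝ => countingFunction p (1 / x)) α) :
    Tendsto (fun t : ℝ => squareLaplace p t / (2 * repeatSum p t / t ^ 2)) atTop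
      (𝓝 (α / 2)) := by
  have hG : 0 < Real.Gamma (2 - α) := Real.Gamma_pos_of_pos (by linarith)
  have h1 := ((tendsto_sq_mul_squareLaplace_div p hα1 hreg).div
    (tendsto_repeatSum_div p hα1 hreg) hG.ne').div_const 2
  rw [mul_div_cancel_right₀ _ hG.ne'] at h1
  refine h1.congr' ?_
  filter_upwards [eventually_gt_atTop 0, hreg.eventually_ne_zero] with t ht hne
  simp only [Pi.div_apply] at *
  field_simp

/-- Each term is `p_j` times `x * exp (-x)` at `x = t p_j`: it tends to `0` and is dominated by
`p_j`. Only summability of `p` is used; for `α = 1` the index of regular variation alone would not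
decide the limit. -/
theorem tendsto_mul_squareLaplace (p : PMF ℕ+) :
    Tendsto (fun t : ℝ => t * squareLaplace p t) atTop (𝓝 0) := by
  have h : Tendsto (fun t : ℝ => ∑' j, t * ((p j).toReal ^ 2 * Real.exp (-(t * (p j).toReal))))
      atTop (𝓝 (∑' _ : ℕ+, 0)) := by
    refine tendsto_tsum_of_dominated_convergence (bound := fun j => (p j).toReal)
      (summable_toReal p) (fun j => ?_) ?_
    · rcases (ENNReal.toReal_nonneg : 0 ≤ (p j).toReal).eq_or_lt with h | h
      · simp [← h]
      · have h1 := (Real.tendsto_pow_mul_exp_neg_atTop_nhds_zero 1).comp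
          (tendsto_id.atTop_mul_const h)
        have h2 := h1.const_mul (p j).toReal
        rw [mul_zero] at h2
        refine h2.congr fun t => ?_
        simp [Function.comp]; ring
    · filter_upwards [eventually_ge_atTop 0] with t ht j
      have h0 : 0 ≤ t * (p j).toReal := by positivity
      rw [Real.norm_of_nonneg (by positivity)]
      have h1 : t * (p j).toReal * Real.exp (-(t * (p j).toReal)) ≤ 1 := by
        rw [Real.exp_neg, ← div_eq_mul_inv, div_le_one (Real.exp_pos _)]
        linarith [Real.add_one_le_exp (t * (p j).toReal)]
      calc t * ((p j).toReal ^ 2 * Real.exp (-(t * (p j).toReal)))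
          = (p j).toReal * (t * (p j).toReal * Real.exp (-(t * (p j).toReal))) := by ring
        _ ≤ _ := mul_le_of_le_one_right (by positivity) h1
  simpa [tsum_mul_left, squareLaplace] using h

end UrnScheme

namespace UrnScheme

/-! ### Independent draws -/

/-- The variables `U 0, U 1, …` are independent draws from `p`. -/
structure IsSample {Ω : Type*} [MeasurableSpace Ω] (μ : Measure Ω) (p : PMF ℕ+)
    (U : ℕ → Ω → ℕ+) : Prop where
  measurable : ∀ i, Measurable (U i)
  map_eq : ∀ i, μ.map (U i) = p.toMeasure
  indep : iIndepFun U μ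

/-- The set of the symbols among the first `n` entries of a sequence. -/
def occupied (n : ℕ) (u : ℕ → ℕ+) : Finset ℕ+ := (Finset.range n).image u

theorem dependsOn_occupied (n : ℕ) : DependsOn (occupied n) (Finset.range n : Set ℕ) := by
  intro u v huv
  exact Finset.image_congr fun i hi => huv i hi

theorem occupied_succ (n : ℕ) (u : ℕ → ℕ+) :
    occupied (n + 1) u = insert (u n) (occupied n u) := by
  rw [occupied, Finset.range_add_one, Finset.image_insert, occupied]

theorem dependsOn_symbolCount (n : ℕ) (j : ℕ+) :
    DependsOn (fun u : ℕ → ℕ+ => symbolCount (fun i u => u i) (fun _ => n) j u)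
      (Finset.range n : Set ℕ) := by
  intro u v huv
  simp only [symbolCount]
  congr 1
  refine Finset.filter_congr fun i hi => ?_
  rw [huv i hi]

theorem symbolCount_succ (n : ℕ) (j : ℕ+) (u : ℕ → ℕ+) :
    symbolCount (fun i u => u i) (fun _ => n + 1) j u
      = symbolCount (fun i u => u i) (fun _ => n) j u + if u n = j then 1 else 0 := by
  simp only [symbolCount, Finset.range_add_one, Finset.filter_insert]
  split_ifs with h
  · rw [Finset.card_insert_of_notMem (by simp)]
  · rfl

theorem symbolCount_eq_zero_iff {Ω : Type*} (U : ℕ → Ω → ℕ+) (T : Ω → ℕ) (j : ℕ+) (ω : Ω) :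
    symbolCount U T j ω = 0 ↔ j ∉ occupied (T ω) (fun i => U i ω) := by
  simp [symbolCount, occupied, Finset.filter_eq_empty_iff]

/-- Such a function factors through finitely many coordinates, that is, through a countable discrete
space, on which every function is measurable. -/
theorem measurable_of_dependsOn {E : Type*} [MeasurableSpace E] {n : ℕ} {G : (ℕ → ℕ+) → E}
    (hG : DependsOn G (Finset.range n : Set ℕ)) : Measurable G := by
  let e : (Finset.range n → ℕ+) → ℕ → ℕ+ := fun x i =>
    if h : i ∈ Finset.range n then x ⟨i, h⟩ else 1
  have h : G = (fun x => G (e x)) ∘ fun u (i : Finset.range n) => u i := by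
    ext u
    refine hG fun i hi => ?_
    simp only [e]
    rw [dif_pos (by simpa using hi)]
  rw [h]
  exact (measurable_of_countable _).comp (by fun_prop)

variable {Ω : Type*} [MeasurableSpace Ω] {μ : Measure Ω} {p : PMF ℕ+} {U : ℕ → Ω → ℕ+}

theorem IsSample.measurable_pi (hU : IsSample μ p U) : Measurable fun ω i => U i ω :=
  measurable_pi_lambda _ hU.measurable

variable [IsProbabilityMeasure μ]

theorem integrable_of_bounded {f : Ω → ℝ} (hf : Measurable f) {C : ℝ} (hC : ∀ ω, |f ω| ≤ C) :
    Integrable f μ :=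
  Integrable.of_bound hf.aestronglyMeasurable C (ae_of_all _ hC)

/-- Integrating out the next draw, given the past. -/
theorem IsSample.integral_next (hU : IsSample μ p U) {E : Type*} {n : ℕ} {G : (ℕ → ℕ+) → E}
    (hG : DependsOn G (Finset.range n : Set ℕ)) {φ : E → ℕ+ → ℝ} {C : ℝ}
    (hφ : ∀ x u, |φ x u| ≤ C) :
    ∫ ω, φ (G fun i => U i ω) (U n ω) ∂μ
      = ∫ ω, ∫ u, φ (G fun i => U i ω) u ∂p.toMeasure ∂μ := by
  let e : (Finset.range n → ℕ+) → ℕ → ℕ+ := fun x i =>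
    if h : i ∈ Finset.range n then x ⟨i, h⟩ else 1
  let X : Ω → Finset.range n → ℕ+ := fun ω i => U i ω
  have hGX : ∀ ω, G (fun i => U i ω) = G (e (X ω)) := by
    intro ω
    refine hG fun i hi => ?_
    simp only [e, X]
    rw [dif_pos (by simpa using hi)]
  have hX : Measurable X := measurable_pi_lambda _ fun i => hU.measurable i
  -- The block of the first `n` draws is independent of draw `n`, so their joint law is a product
  -- and Fubini applies.
  have hind : IndepFun X (U n) μ := by
    have h := hU.indep.indepFun_finset (Finset.range n) {n} (by simp) hU.measurable
    exact h.comp (φ := id) (ψ := fun x : ({n} : Finset ℕ) → ℕ+ => x ⟨n, by simp⟩) measurable_id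
      (measurable_pi_apply _)
  have hmap := hind.map_prod_eq_prod_map_map hX.aemeasurable (hU.measurable n).aemeasurable
  rw [hU.map_eq n] at hmap
  have : IsProbabilityMeasure (μ.map X) := Measure.isProbabilityMeasure_map hX.aemeasurable
  have hmeas : Measurable fun z : (Finset.range n → ℕ+) × ℕ+ => φ (G (e z.1)) z.2 :=
    measurable_of_countable _
  simp_rw [hGX]
  calc ∫ ω, φ (G (e (X ω))) (U n ω) ∂μ
      = ∫ z, φ (G (e z.1)) z.2 ∂(μ.map fun ω => (X ω, U n ω)) := by
        rw [integral_map (hX.prodMk (hU.measurable n)).aemeasurable hmeas.aestronglyMeasurable]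
    _ = ∫ x, ∫ u, φ (G (e x)) u ∂p.toMeasure ∂(μ.map X) := by
        rw [hmap, integral_prod _ (integrable_of_bounded hmeas fun z => hφ _ _)]
    _ = _ := by
        rw [integral_map hX.aemeasurable (measurable_of_countable _).aestronglyMeasurable]

theorem toMeasure_real_singleton (p : PMF ℕ+) (k : ℕ+) :
    p.toMeasure.real {k} = (p k).toReal := by
  rw [measureReal_def, PMF.toMeasure_apply_singleton _ _ (measurableSet_singleton k)]

theorem toMeasure_real_finset (p : PMF ℕ+) (A : Finset ℕ+) :
    p.toMeasure.real A = ∑ j ∈ A, (p j).toReal := by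
  rw [← sum_measureReal_singleton]
  exact Finset.sum_congr rfl fun j _ => toMeasure_real_singleton p j

/-- The probability that no symbol of `A` is drawn. -/
theorem IsSample.integral_unoccupied (hU : IsSample μ p U) (A : Finset ℕ+) (n : ℕ) :
    ∫ ω, (if ∀ j ∈ A, j ∉ occupied n (fun i => U i ω) then (1 : ℝ) else 0) ∂μ
      = (1 - ∑ j ∈ A, (p j).toReal) ^ n := by
  induction n with
  | zero => simp [occupied]
  | succ n ih =>
    have h1 : ∀ ω, (if ∀ j ∈ A, j ∉ occupied (n + 1) (fun i => U i ω) then (1 : ℝ) else 0)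
        = if (∀ j ∈ A, j ∉ occupied n (fun i => U i ω)) ∧ U n ω ∉ A then 1 else 0 := by
      intro ω
      refine if_congr ?_ rfl rfl
      simp only [occupied_succ, Finset.mem_insert, not_or]
      exact ⟨fun h => ⟨fun j hj => (h j hj).2, fun hj => (h _ hj).1 rfl⟩,
        fun h j hj => ⟨fun hj' => h.2 (hj' ▸ hj), h.1 j hj⟩⟩
    simp_rw [h1]
    rw [hU.integral_next (dependsOn_occupied n)
      (φ := fun S u => if (∀ j ∈ A, j ∉ S) ∧ u ∉ A then 1 else 0) (C := 1)
      (fun S u => by split_ifs <;> simp)]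
    have h2 : ∀ S : Finset ℕ+, ∫ u, (if (∀ j ∈ A, j ∉ S) ∧ u ∉ A then (1 : ℝ) else 0) ∂p.toMeasure
        = (if ∀ j ∈ A, j ∉ S then (1 : ℝ) else 0) * (1 - ∑ j ∈ A, (p j).toReal) := by
      intro S
      by_cases hS : ∀ j ∈ A, j ∉ S
      · simp only [if_pos hS, one_mul, and_iff_right hS]
        have h3 : (fun u => if u ∉ A then (1 : ℝ) else 0)
            = ((A : Set ℕ+)ᶜ).indicator fun _ => (1 : ℝ) := by
          ext u; simp [Set.indicator]
        rw [h3, integral_indicator_const _ A.measurableSet.compl, smul_eq_mul, mul_one,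
          probReal_compl_eq_one_sub A.measurableSet, toMeasure_real_finset]
      · simp [hS]
    simp_rw [h2]
    rw [integral_mul_const, ih, pow_succ]

/-- The number of occurrences of a symbol in `n` draws is binomial. -/
theorem IsSample.integral_symbolCount_eq (hU : IsSample μ p U) (j : ℕ+) (n r : ℕ) :
    ∫ ω, (if symbolCount U (fun _ => n) j ω = r then (1 : ℝ) else 0) ∂μ
      = n.choose r * (p j).toReal ^ r * (1 - (p j).toReal) ^ (n - r) := by
  induction n generalizing r with
  | zero => cases r <;> simp [symbolCount]
  | succ n ih =>
    let K : (ℕ → ℕ+) → ℕ := fun u => symbolCount (fun i u => u i) (fun _ => n) j u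
    have h1 : ∀ ω, symbolCount U (fun _ => n + 1) j ω
        = K (fun i => U i ω) + if U n ω = j then 1 else 0 := fun ω => symbolCount_succ n j _
    simp_rw [h1]
    rw [hU.integral_next (dependsOn_symbolCount n j)
      (φ := fun c u => if c + (if u = j then 1 else 0) = r then (1 : ℝ) else 0) (C := 1)
      (fun S u => by split_ifs <;> simp)]
    have h2 : ∀ c : ℕ, ∫ u, (if c + (if u = j then 1 else 0) = r then (1 : ℝ) else 0) ∂p.toMeasure
        = (p j).toReal * (if c + 1 = r then 1 else 0)
          + (1 - (p j).toReal) * (if c = r then 1 else 0) := by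
      intro c
      rw [← integral_add_compl (measurableSet_singleton j)
        (integrable_of_bounded (C := 1) (measurable_of_countable _)
          fun u => by split_ifs <;> simp), integral_singleton, toMeasure_real_singleton]
      have h3 : ∫ u in {j}ᶜ, (if c + (if u = j then 1 else 0) = r then (1 : ℝ) else 0) ∂p.toMeasure
          = ∫ u in {j}ᶜ, (if c = r then (1 : ℝ) else 0) ∂p.toMeasure := by
        refine setIntegral_congr_fun (measurableSet_singleton j).compl fun u hu => ?_
        have : u ≠ j := hu
        simp [this]
      rw [h3, setIntegral_const, probReal_compl_eq_one_sub (measurableSet_singleton j),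
        toMeasure_real_singleton]
      simp
    simp_rw [h2]
    have hint : ∀ s, Integrable (fun ω => if K (fun i => U i ω) = s then (1 : ℝ) else 0) μ :=
      fun s => integrable_of_bounded (C := 1)
        ((measurable_of_countable fun c : ℕ => if c = s then (1 : ℝ) else 0).comp
          ((measurable_of_dependsOn (dependsOn_symbolCount n j)).comp hU.measurable_pi))
        fun ω => by split_ifs <;> simp
    have ih' : ∀ s, ∫ ω, (if K (fun i => U i ω) = s then (1 : ℝ) else 0) ∂μ
        = n.choose s * (p j).toReal ^ s * (1 - (p j).toReal) ^ (n - s) := ih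
    cases r with
    | zero =>
      simp only [Nat.add_eq_zero_iff, one_ne_zero, and_false, if_false, mul_zero, zero_add]
      rw [integral_const_mul, ih']
      simp [pow_succ']
    | succ r =>
      simp only [Nat.add_right_cancel_iff]
      rw [integral_add ((hint _).const_mul _) ((hint _).const_mul _), integral_const_mul,
        integral_const_mul, ih', ih', Nat.choose_succ_succ, Nat.cast_add, Nat.succ_sub_succ]
      -- Pascal's rule closes the case `r < n`. For `n ≤ r` the subtraction `n - (r + 1)` truncates,
      -- but its term carries `n.choose (r + 1) = 0`.
      rcases lt_or_ge r n with h | h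
      · rw [show n - r = n - (r + 1) + 1 by omega]
        ring
      · rw [Nat.choose_eq_zero_of_lt (Nat.lt_succ_of_le h)]
        simp; ring

end UrnScheme

namespace UrnScheme

variable {Ω : Type*} [MeasurableSpace Ω] {μ : Measure Ω} {p : PMF ℕ+} {U : ℕ → Ω → ℕ+}

/-! ### Negative association of the occupancy indicators -/

variable [IsProbabilityMeasure μ]

theorem IsSample.integrable_occupied (hU : IsSample μ p U) (n : ℕ) {h : Finset ℕ+ → ℝ} {C : ℝ}
    (hC : ∀ S, |h S| ≤ C) : Integrable (fun ω => h (occupied n fun i => U i ω)) μ :=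
  integrable_of_bounded
    ((measurable_of_dependsOn (G := fun u => h (occupied n u))
      fun _ _ huv => congrArg h (dependsOn_occupied n huv)).comp hU.measurable_pi) fun _ => hC _

/-- An increasing function of the other symbols is negatively correlated with the occupancy of
the symbol `k`. -/
theorem IsSample.pow_mul_integral_le (hU : IsSample μ p U) (k : ℕ+) (n : ℕ) {h : Finset ℕ+ → ℝ}
    (hmono : Monotone h) (hk : ∀ S, h (insert k S) = h S) {C : ℝ} (hC : ∀ S, |h S| ≤ C) :
    (1 - (p k).toReal) ^ n * ∫ ω, h (occupied n fun i => U i ω) ∂μ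
      ≤ ∫ ω, (if k ∈ occupied n (fun i => U i ω) then 0
          else h (occupied n fun i => U i ω)) ∂μ := by
  have hp1 := toReal_le_one p k
  have hp0 : 0 ≤ (p k).toReal := ENNReal.toReal_nonneg
  induction n generalizing h with
  | zero => simp [occupied]
  | succ n ih =>
    have hC0 : 0 ≤ C := (abs_nonneg _).trans (hC ∅)
    have hint : ∀ S, Integrable (fun u => h (insert u S)) p.toMeasure := fun S =>
      integrable_of_bounded (measurable_of_countable _) fun u => hC _
    -- `g` averages `h` over a next draw different from `k`; it is again monotone, bounded and blind
    -- to `k`, so the induction hypothesis applies to it. A draw equal to `k` leaves `h` unchanged,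
    -- hence the full average is `p_k h + g`. From `(1 - p_k) h ≤ g` it follows that `(1 - p_k) (p_k
    -- h + g) ≤ g`, which is the inductive step.
    let g : Finset ℕ+ → ℝ := fun S => ∫ u in {k}ᶜ, h (insert u S) ∂p.toMeasure
    have hgC : ∀ S, |g S| ≤ C := by
      intro S
      refine (norm_setIntegral_le_of_norm_le_const (μ := p.toMeasure) (C := C)
        (f := fun u => h (insert u S)) (measure_lt_top _ _) fun u _ => hC _).trans ?_
      exact mul_le_of_le_one_right hC0 measureReal_le_one
    have hgk : ∀ S, g (insert k S) = g S := fun S => by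
      simp only [g, Finset.insert_comm _ k, hk]
    have hgmono : Monotone g := fun S S' hS =>
      setIntegral_mono (hint S).integrableOn (hint S').integrableOn fun u =>
        hmono (Finset.insert_subset_insert _ hS)
    have hsplit : ∀ S, ∫ u, h (insert u S) ∂p.toMeasure = (p k).toReal * h S + g S := by
      intro S
      rw [← integral_add_compl (measurableSet_singleton k) (hint S), integral_singleton,
        toMeasure_real_singleton, hk, smul_eq_mul]
    have hge : ∀ S, (1 - (p k).toReal) * h S ≤ g S := by
      intro S
      have h1 : ∫ u in {k}ᶜ, h S ∂p.toMeasure ≤ g S :=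
        setIntegral_mono (integrable_const _) (hint S).integrableOn fun u =>
          hmono (Finset.subset_insert _ _)
      rwa [setIntegral_const, probReal_compl_eq_one_sub (measurableSet_singleton k),
        toMeasure_real_singleton, smul_eq_mul] at h1
    have hR : ∫ ω, (if k ∈ occupied (n + 1) (fun i => U i ω) then 0
          else h (occupied (n + 1) fun i => U i ω)) ∂μ
        = ∫ ω, (if k ∈ occupied n (fun i => U i ω) then 0
          else g (occupied n fun i => U i ω)) ∂μ := by
      simp_rw [occupied_succ]
      rw [hU.integral_next (dependsOn_occupied n)
        (φ := fun S u => if k ∈ insert u S then 0 else h (insert u S)) (C := C)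
        (fun S u => by split_ifs; exacts [by simpa using hC0, hC _])]
      congr 1
      ext ω
      by_cases hS : k ∈ occupied n fun i => U i ω
      · simp [hS]
      · simp only [g]
        rw [if_neg hS, ← integral_indicator (measurableSet_singleton k).compl]
        congr 1
        ext u
        by_cases huk : u = k
        · simp [huk]
        · simp [huk, Ne.symm huk, hS]
    have hL : ∫ ω, h (occupied (n + 1) fun i => U i ω) ∂μ
        = ∫ ω, ((p k).toReal * h (occupied n fun i => U i ω)
          + g (occupied n fun i => U i ω)) ∂μ := by
      simp_rw [occupied_succ]
      rw [hU.integral_next (dependsOn_occupied n)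
        (φ := fun S u => h (insert u S)) (C := C) fun S u => hC _]
      simp_rw [hsplit]
    rw [hR, hL]
    refine le_trans ?_ (ih hgmono hgk hgC)
    rw [pow_succ, mul_assoc, ← integral_const_mul]
    have := pow_nonneg (sub_nonneg.2 hp1) n
    gcongr ?_ * ?_
    refine integral_mono ((((hU.integrable_occupied n hC).const_mul _).add
      (hU.integrable_occupied n hgC)).const_mul _) (hU.integrable_occupied n hgC) fun ω => ?_
    have := hge (occupied n fun i => U i ω)
    nlinarith

/-- The weight carried by the unoccupied symbols of `J`. -/
def unoccupiedProd (b : ℕ+ → ℝ) (J S : Finset ℕ+) : ℝ := ∏ j ∈ J, if j ∈ S then 1 else b j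

theorem unoccupiedProd_insert (b : ℕ+ → ℝ) {J : Finset ℕ+} {k : ℕ+} (hk : k ∉ J) (S : Finset ℕ+) :
    unoccupiedProd b (insert k J) S = unoccupiedProd b J S
      + (b k - 1) * if k ∈ S then 0 else unoccupiedProd b J S := by
  rw [unoccupiedProd, Finset.prod_insert hk, ← unoccupiedProd]
  split_ifs <;> ring

theorem unoccupiedProd_insert_right (b : ℕ+ → ℝ) {J : Finset ℕ+} {k : ℕ+} (hk : k ∉ J)
    (S : Finset ℕ+) : unoccupiedProd b J (insert k S) = unoccupiedProd b J S := by
  refine Finset.prod_congr rfl fun j hj => ?_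
  have : j ≠ k := fun h => hk (h ▸ hj)
  simp [this]

theorem unoccupiedProd_nonneg {b : ℕ+ → ℝ} (hb : ∀ j, 0 ≤ b j) (J S : Finset ℕ+) :
    0 ≤ unoccupiedProd b J S :=
  Finset.prod_nonneg fun j _ => by split_ifs; exacts [zero_le_one, hb j]

theorem abs_unoccupiedProd_le {b : ℕ+ → ℝ} (hb : ∀ j, 0 ≤ b j) (J S : Finset ℕ+) :
    |unoccupiedProd b J S| ≤ ∏ j ∈ J, (1 + b j) := by
  rw [abs_of_nonneg (unoccupiedProd_nonneg hb J S)]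
  refine Finset.prod_le_prod (fun j _ => by split_ifs; exacts [zero_le_one, hb j]) fun j _ => ?_
  have := hb j
  split_ifs <;> linarith

theorem monotone_unoccupiedProd {b : ℕ+ → ℝ} (hb : ∀ j, 0 ≤ b j) (hb1 : ∀ j, b j ≤ 1)
    (J : Finset ℕ+) : Monotone (unoccupiedProd b J) := fun S S' hS =>
  Finset.prod_le_prod (fun j _ => by split_ifs; exacts [zero_le_one, hb j]) fun j _ => by
    split_ifs with h h'
    · rfl
    · exact absurd (hS h) h'
    · exact hb1 j
    · rfl

theorem antitone_unoccupiedProd {b : ℕ+ → ℝ} (hb1 : ∀ j, 1 ≤ b j)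
    (J : Finset ℕ+) : Antitone (unoccupiedProd b J) := fun S S' hS =>
  Finset.prod_le_prod (fun j _ => by split_ifs; exacts [zero_le_one, zero_le_one.trans (hb1 j)])
    fun j _ => by
      split_ifs with h' h h
      · rfl
      · exact hb1 j
      · exact absurd (hS h) h'
      · rfl

/-- Peeling off `k` adds `(b k - 1)` times the integral of the remaining product over the event that
`k` is absent. The remaining product ignores `k`; it increases with the occupied set if all `b j ≤
1` and decreases if all `b j ≥ 1`. In both cases the direction of the correlation inequality matches
the sign of `b k - 1`, so the upper bound comes out; this is why all `b j` must lie on the same side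
of `1`. -/
theorem IsSample.integral_unoccupiedProd_le (hU : IsSample μ p U) (n : ℕ) {b : ℕ+ → ℝ}
    (hb : ∀ j, 0 ≤ b j) (hb1 : (∀ j, b j ≤ 1) ∨ ∀ j, 1 ≤ b j) (J : Finset ℕ+) :
    ∫ ω, unoccupiedProd b J (occupied n fun i => U i ω) ∂μ
      ≤ ∏ j ∈ J, (1 + (b j - 1) * (1 - (p j).toReal) ^ n) := by
  induction J using Finset.induction_on with
  | empty => simp [unoccupiedProd]
  | insert k J hk ih =>
    have hp1 := toReal_le_one p k
    have hp0 : 0 ≤ (p k).toReal := ENNReal.toReal_nonneg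
    have hq0 : 0 ≤ (1 - (p k).toReal) ^ n := pow_nonneg (sub_nonneg.2 hp1) n
    have hq1 : (1 - (p k).toReal) ^ n ≤ 1 := pow_le_one₀ (sub_nonneg.2 hp1) (by linarith)
    have hC := abs_unoccupiedProd_le hb J
    have hint := hU.integrable_occupied n hC
    have hint' := hU.integrable_occupied n (h := fun S => if k ∈ S then 0 else unoccupiedProd b J S)
      (C := ∏ j ∈ J, (1 + b j)) fun S => by
        split_ifs
        · simpa using (abs_nonneg _).trans (hC ∅)
        · exact hC S
    simp_rw [unoccupiedProd_insert b hk]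
    rw [integral_add hint (hint'.const_mul _), integral_const_mul, Finset.prod_insert hk]
    set I := ∫ ω, unoccupiedProd b J (occupied n fun i => U i ω) ∂μ
    have hkey : (b k - 1) * ∫ ω, (if k ∈ occupied n (fun i => U i ω) then 0
          else unoccupiedProd b J (occupied n fun i => U i ω)) ∂μ
        ≤ (b k - 1) * ((1 - (p k).toReal) ^ n * I) := by
      rcases hb1 with hb1 | hb1
      · exact mul_le_mul_of_nonpos_left (hU.pow_mul_integral_le k n
          (monotone_unoccupiedProd hb hb1 J) (unoccupiedProd_insert_right b hk) hC)
          (sub_nonpos.2 (hb1 k))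
      · refine mul_le_mul_of_nonneg_left ?_ (sub_nonneg.2 (hb1 k))
        have h := hU.pow_mul_integral_le k n (h := fun S => -unoccupiedProd b J S)
          (antitone_unoccupiedProd hb1 J).neg
          (fun S => by rw [unoccupiedProd_insert_right b hk]) fun S => by rw [abs_neg]; exact hC S
        rw [integral_neg] at h
        have h2 : ∀ S : Finset ℕ+, (if k ∈ S then (0 : ℝ) else -unoccupiedProd b J S)
            = -if k ∈ S then 0 else unoccupiedProd b J S := fun S => by split_ifs <;> simp
        simp_rw [h2] at h
        rw [integral_neg] at h
        linarith
    have hfac : 0 ≤ 1 + (b k - 1) * (1 - (p k).toReal) ^ n := by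
      have := mul_nonneg (hb k) hq0
      nlinarith
    have := mul_le_mul_of_nonneg_left ih hfac
    linarith

end UrnScheme

namespace UrnScheme

variable {Ω : Type*} [MeasurableSpace Ω] {μ : Measure Ω} {p : PMF ℕ+} {U : ℕ → Ω → ℕ+}
  {T : Ω → ℕ}

/-! ### Poisson sample size -/

/-- `T` is a Poisson variable with mean `r`, independent of the draws. -/
structure IsPoissonSize (μ : Measure Ω) (U : ℕ → Ω → ℕ+) (T : Ω → ℕ) (r : ℝ≥0) : Prop where
  measurable : Measurable T
  map_eq : μ.map T = poissonMeasure r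
  indep : IndepFun T (fun ω i => U i ω) μ

theorem measurable_comp_symbolCount_coord {E : Type*} [MeasurableSpace E] (m : ℕ) (j : ℕ+) (f : ℕ → E) :
    Measurable fun u : ℕ → ℕ+ => f (symbolCount (fun i u => u i) (fun _ => m) j u) :=
  measurable_of_dependsOn fun _ _ huv => congrArg f (dependsOn_symbolCount m j huv)

theorem measurable_comp_occupied_coord {E : Type*} [MeasurableSpace E] (m : ℕ) (f : Finset ℕ+ → E) :
    Measurable fun u : ℕ → ℕ+ => f (occupied m u) :=
  measurable_of_dependsOn fun _ _ huv => congrArg f (dependsOn_occupied m huv)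

theorem measurable_comp_occupied (hT : Measurable T) (hU : IsSample μ p U) {E : Type*}
    [MeasurableSpace E] (f : Finset ℕ+ → E) :
    Measurable fun ω => f (occupied (T ω) fun i => U i ω) :=
  (measurable_from_prod_countable_right (f := fun z : ℕ × (ℕ → ℕ+) => f (occupied z.1 z.2))
    fun m => measurable_comp_occupied_coord m f).comp (hT.prodMk hU.measurable_pi)

theorem measurable_comp_symbolCount (hT : Measurable T) (hU : IsSample μ p U) (j : ℕ+) {E : Type*}
    [MeasurableSpace E] (f : ℕ → E) :
    Measurable fun ω => f (symbolCount U T j ω) :=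
  (measurable_from_prod_countable_right
    (f := fun z : ℕ × (ℕ → ℕ+) => f (symbolCount (fun i (u : ℕ → ℕ+) => u i) (fun _ => z.1) j z.2))
    fun m => measurable_comp_symbolCount_coord m j f).comp (hT.prodMk hU.measurable_pi)

variable [IsProbabilityMeasure μ] {r : ℝ≥0}

theorem IsPoissonSize.hasSum_integral (hT : IsPoissonSize μ U T r) (hU : IsSample μ p U)
    {φ : ℕ → (ℕ → ℕ+) → ℝ} (hφ : ∀ m, Measurable (φ m)) {C : ℝ} (hC : ∀ m u, |φ m u| ≤ C) :
    HasSum (fun m : ℕ => Real.exp (-r) * r ^ m / m.factorial * ∫ ω, φ m (fun i => U i ω) ∂μ)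
      (∫ ω, φ (T ω) (fun i => U i ω) ∂μ) := by
  have hmap := hT.indep.map_prod_eq_prod_map_map hT.measurable.aemeasurable
    hU.measurable_pi.aemeasurable
  rw [hT.map_eq] at hmap
  have : IsProbabilityMeasure (μ.map fun ω i => U i ω) :=
    Measure.isProbabilityMeasure_map hU.measurable_pi.aemeasurable
  have hmeas : Measurable fun z : ℕ × (ℕ → ℕ+) => φ z.1 z.2 :=
    measurable_from_prod_countable_right hφ
  have h : ∫ ω, φ (T ω) (fun i => U i ω) ∂μ
      = ∫ m, ∫ u, φ m u ∂(μ.map fun ω i => U i ω) ∂poissonMeasure r := by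
    rw [← integral_prod (fun z : ℕ × (ℕ → ℕ+) => φ z.1 z.2)
      (integrable_of_bounded hmeas fun z => hC _ _), ← hmap,
      integral_map (hT.measurable.prodMk hU.measurable_pi).aemeasurable hmeas.aestronglyMeasurable]
  rw [h]
  have hint : Integrable (fun m => ∫ u, φ m u ∂(μ.map fun ω i => U i ω)) (poissonMeasure r) :=
    integrable_of_bounded (C := C) (measurable_of_countable _) fun m => by
      refine (norm_integral_le_of_norm_le_const (f := φ m) (C := C)
        (ae_of_all _ fun u => hC m u)).trans ?_
      simp
  refine (hasSum_integral_poissonMeasure hint).congr_fun fun m => ?_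
  rw [smul_eq_mul, integral_map hU.measurable_pi.aemeasurable (hφ _).aestronglyMeasurable]

/-- Averaging `(1 - P(A)) ^ m` over a Poisson `m` gives `exp (-r P(A))`, which factors over the
symbols of `A`. This is the independence created by Poissonization. -/
theorem IsPoissonSize.integral_unoccupied (hT : IsPoissonSize μ U T r) (hU : IsSample μ p U)
    (A : Finset ℕ+) :
    ∫ ω, (if ∀ j ∈ A, j ∉ occupied (T ω) (fun i => U i ω) then (1 : ℝ) else 0) ∂μ
      = ∏ j ∈ A, Real.exp (-(r * (p j).toReal)) := by
  have h := hT.hasSum_integral hU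
    (φ := fun m u => if ∀ j ∈ A, j ∉ occupied m u then (1 : ℝ) else 0)
    (fun m => measurable_comp_occupied_coord m fun S => if ∀ j ∈ A, j ∉ S then (1 : ℝ) else 0)
    (C := 1) fun m u => by split_ifs <;> simp
  simp_rw [hU.integral_unoccupied] at h
  have h2 := (NormedSpace.expSeries_div_hasSum_exp
    (r * (1 - ∑ j ∈ A, (p j).toReal) : ℝ)).mul_left (Real.exp (-r))
  rw [← Real.exp_eq_exp_ℝ, ← Real.exp_add] at h2
  refine (h.unique (h2.congr_fun fun m => ?_)).trans ?_
  · rw [mul_pow]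
    ring
  · rw [← Real.exp_sum, Finset.sum_neg_distrib, ← Finset.mul_sum]
    ring_nf

theorem IsPoissonSize.integral_symbolCount_eq (hT : IsPoissonSize μ U T r) (hU : IsSample μ p U)
    (j : ℕ+) (k : ℕ) :
    ∫ ω, (if symbolCount U T j ω = k then (1 : ℝ) else 0) ∂μ
      = Real.exp (-(r * (p j).toReal)) * (r * (p j).toReal) ^ k / k.factorial := by
  have h := hT.hasSum_integral hU
    (φ := fun m u => if symbolCount (fun i u => u i) (fun _ => m) j u = k then (1 : ℝ) else 0)
    (fun m => measurable_comp_symbolCount_coord m j fun c => if c = k then (1 : ℝ) else 0)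
    (C := 1) fun m u => by split_ifs <;> simp
  have h1 : ∀ m, ∫ ω, (if symbolCount (fun i u => u i) (fun _ => m) j (fun i => U i ω) = k
      then (1 : ℝ) else 0) ∂μ = _ := fun m => hU.integral_symbolCount_eq j m k
  simp_rw [h1] at h
  have h2 := (NormedSpace.expSeries_div_hasSum_exp
    (r * (1 - (p j).toReal) : ℝ)).mul_left (Real.exp (-r) * (r * (p j).toReal) ^ k / k.factorial)
  rw [← Real.exp_eq_exp_ℝ] at h2
  -- The terms with `m < k` vanish with the binomial coefficient, and after the shift by `k` the
  -- rest is an exponential series.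
  rw [← hasSum_nat_add_iff' k, Finset.sum_eq_zero, sub_zero] at h
  · refine (h.unique (h2.congr_fun ?_)).trans ?_
    · intro m
      have hf := Nat.add_choose_mul_factorial_mul_factorial m k
      have hf' : ((m + k).choose k : ℝ) * m.factorial * k.factorial = (m + k).factorial := by
        exact_mod_cast hf
      rw [Nat.add_sub_cancel, ← hf', mul_pow (r : ℝ) (1 - _)]
      have := Nat.factorial_pos m
      have := Nat.factorial_pos k
      have := Nat.choose_pos (Nat.le_add_left k m)
      field_simp
      ring
    · rw [mul_div_assoc, mul_right_comm, mul_div_assoc, ← Real.exp_add]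
      ring_nf
  · intro m hm
    rw [Nat.choose_eq_zero_of_lt (Finset.mem_range.1 hm)]
    simp

/-- Expanding the product reduces its expectation to the probabilities that all symbols of a finite
set are absent. -/
theorem unoccupiedProd_eq_sum (b : ℕ+ → ℝ) (J S : Finset ℕ+) :
    unoccupiedProd b J S
      = ∑ A ∈ J.powerset, (∏ j ∈ A, (b j - 1)) * if ∀ j ∈ A, j ∉ S then 1 else 0 := by
  have h : unoccupiedProd b J S = ∏ j ∈ J, (1 + (b j - 1) * if j ∉ S then 1 else 0) :=
    Finset.prod_congr rfl fun j _ => by by_cases h : j ∈ S <;> simp [h]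
  rw [h, Finset.prod_one_add]
  refine Finset.sum_congr rfl fun A _ => ?_
  rw [Finset.prod_mul_distrib]
  congr 1
  by_cases hA : ∀ j ∈ A, j ∉ S
  · rw [if_pos hA]
    exact Finset.prod_eq_one fun j hj => if_pos (hA j hj)
  · rw [if_neg hA]
    push Not at hA
    obtain ⟨j, hj, hjS⟩ := hA
    exact Finset.prod_eq_zero hj (by simp [hjS])

theorem IsPoissonSize.integral_unoccupiedProd (hT : IsPoissonSize μ U T r) (hU : IsSample μ p U)
    (b : ℕ+ → ℝ) (J : Finset ℕ+) :
    ∫ ω, unoccupiedProd b J (occupied (T ω) fun i => U i ω) ∂μ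
      = ∏ j ∈ J, (1 + (b j - 1) * Real.exp (-(r * (p j).toReal))) := by
  simp_rw [unoccupiedProd_eq_sum]
  rw [integral_finsetSum]
  · simp_rw [integral_const_mul, hT.integral_unoccupied hU, ← Finset.prod_mul_distrib]
    rw [Finset.prod_one_add]
  · intro A _
    exact (integrable_of_bounded (C := 1) (measurable_comp_occupied hT.measurable hU
      fun S => if ∀ j ∈ A, j ∉ S then (1 : ℝ) else 0)
        fun ω => by split_ifs <;> simp).const_mul _

end UrnScheme

namespace UrnScheme

/-! ### The missing mass -/

theorem hasSum_missingMass {Ω : Type*} (p : PMF ℕ+) (U : ℕ → Ω → ℕ+) (T : Ω → ℕ) (ω : Ω) :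
    HasSum (fun j => (p j).toReal * if j ∉ occupied (T ω) (fun i => U i ω) then 1 else 0)
      (missingMass p U T ω) := by
  have h : Summable fun j => (p j).toReal *
      if j ∉ occupied (T ω) (fun i => U i ω) then (1 : ℝ) else 0 :=
    (summable_toReal p).of_nonneg_of_le (fun j => by positivity) fun j =>
      mul_le_of_le_one_right ENNReal.toReal_nonneg (by split_ifs <;> simp)
  convert! h.hasSum using 1
  refine tsum_congr fun j => ?_
  simp only [symbolCount_eq_zero_iff, mul_ite, mul_one, mul_zero]

theorem missingMass_nonneg {Ω : Type*} (p : PMF ℕ+) (U : ℕ → Ω → ℕ+) (T : Ω → ℕ) (ω : Ω) :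
    0 ≤ missingMass p U T ω :=
  (hasSum_missingMass p U T ω).nonneg fun j => by positivity

theorem missingMass_le_one {Ω : Type*} (p : PMF ℕ+) (U : ℕ → Ω → ℕ+) (T : Ω → ℕ) (ω : Ω) :
    missingMass p U T ω ≤ 1 := by
  rw [← tsum_toReal p]
  exact hasSum_le (fun j => mul_le_of_le_one_right ENNReal.toReal_nonneg
    (by split_ifs <;> simp)) (hasSum_missingMass p U T ω) (summable_toReal p).hasSum

variable {Ω : Type*} [MeasurableSpace Ω] {μ : Measure Ω} {p : PMF ℕ+} {U : ℕ → Ω → ℕ+}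
  {T : Ω → ℕ}

theorem measurable_missingMass (hT : Measurable T) (hU : IsSample μ p U) :
    Measurable (missingMass p U T) := by
  have h := measurable_comp_occupied hT hU
    fun S => ∑' j, (p j).toReal * if j ∉ S then (1 : ℝ) else 0
  convert! h using 1
  ext ω
  exact (hasSum_missingMass p U T ω).tsum_eq.symm

/-! ### Elementary inequalities for the exponential -/

/-- Bound `exp (-x)` below by its quadratic Taylor polynomial and invert, using `(1 + x + x² / 2) (1
- x + x² / 2) = 1 + x⁴ / 4 ≥ 1`. -/
theorem exp_le_quadratic_of_nonpos {x : ℝ} (hx : x ≤ 0) : Real.exp x ≤ 1 + x + x ^ 2 / 2 := by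
  have h := Real.quadratic_le_exp_of_nonneg (neg_nonneg.2 hx)
  rw [Real.exp_neg] at h
  have h1 : 0 < 1 + -x + (-x) ^ 2 / 2 := by nlinarith [sq_nonneg x]
  have h2 := (le_inv_comm₀ h1 (Real.exp_pos x)).1 h
  refine h2.trans ?_
  rw [inv_le_iff_one_le_mul₀ h1]
  nlinarith [sq_nonneg (x ^ 2)]

/-- Both power series start at order two, and `t ^ (k + 2) ≤ t ^ 2` term by term. -/
theorem exp_mul_sub_le {t x : ℝ} (ht0 : 0 ≤ t) (ht1 : t ≤ 1) (hx : 0 ≤ x) :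
    Real.exp (t * x) - 1 - t * x ≤ t ^ 2 * (Real.exp x - 1 - x) := by
  have h : ∀ y : ℝ, HasSum (fun k : ℕ => y ^ (k + 2) / (k + 2).factorial)
      (Real.exp y - 1 - y) := by
    intro y
    have := (hasSum_nat_add_iff' 2).2 (NormedSpace.expSeries_div_hasSum_exp y)
    simpa [Finset.sum_range_succ, Real.exp_eq_exp_ℝ, sub_sub] using this
  refine hasSum_le (fun k => ?_) (h (t * x)) ((h x).mul_left (t ^ 2))
  rw [← mul_div_assoc]
  gcongr
  rw [mul_pow, pow_add t]
  have h1 : t ^ k ≤ 1 := pow_le_one₀ ht0 ht1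
  have h2 : 0 ≤ t ^ 2 * x ^ (k + 2) := by positivity
  nlinarith

theorem one_sub_exp_neg_mul_nonneg {x : ℝ} : 0 ≤ 1 - Real.exp (-x) * (1 + x) := by
  rw [sub_nonneg, Real.exp_neg, inv_mul_le_iff₀ (Real.exp_pos x), mul_one, add_comm]
  exact Real.add_one_le_exp x

theorem one_sub_exp_neg_mul_le {x : ℝ} (hx : 0 ≤ x) : 1 - Real.exp (-x) * (1 + x) ≤ x ^ 2 := by
  have := Real.add_one_le_exp (-x)
  nlinarith

/-- This follows from `1 + x + x⁴ / 24 ≤ exp x`. It serves to bound fourth-order errors by terms of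
`repeatSum`, whose growth is known. -/
theorem pow_four_mul_exp_neg_le {x : ℝ} (hx : 0 ≤ x) :
    x ^ 4 * Real.exp (-x) ≤ 24 * (1 - Real.exp (-x) * (1 + x)) := by
  have h := Real.sum_le_exp_of_nonneg hx 5
  simp only [Finset.sum_range_succ, Finset.sum_range_zero, Nat.factorial] at h
  have h1 : Real.exp x * Real.exp (-x) = 1 := by rw [← Real.exp_add]; simp
  have h2 := Real.exp_pos (-x)
  have h3 : x ^ 4 + 24 * (1 + x) ≤ 24 * Real.exp x := by
    have : 0 ≤ x ^ 2 := by positivity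
    have : 0 ≤ x ^ 3 := by positivity
    norm_num at h
    linarith
  have h4 := mul_le_mul_of_nonneg_right h3 h2.le
  rw [mul_assoc 24, h1] at h4
  linarith

theorem summable_repeatSum (p : PMF ℕ+) {t : ℝ} (ht : 0 ≤ t) :
    Summable fun j => 1 - Real.exp (-(t * (p j).toReal)) * (1 + t * (p j).toReal) :=
  ((summable_toReal_sq p).mul_left (t ^ 2)).of_nonneg_of_le
    (fun _ => one_sub_exp_neg_mul_nonneg) fun j => by
      rw [← mul_pow]
      exact one_sub_exp_neg_mul_le (by positivity)

/-! ### Expected occupancy counts -/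

variable [IsProbabilityMeasure μ]

/-- Because `Q 0` fails, the counted symbols all lie in the finite occupied set, so `ncard` is a
genuine count and not its default value `0`. -/
theorem integral_ncard_symbolCount (hT : Measurable T) (hU : IsSample μ p U) {Q : ℕ → Prop}
    [DecidablePred Q] (hQ : ¬ Q 0)
    (hsum : Summable fun j => ∫ ω, (if Q (symbolCount U T j ω) then (1 : ℝ) else 0) ∂μ) :
    ∫ ω, (Set.ncard {j : ℕ+ | Q (symbolCount U T j ω)} : ℝ) ∂μ
      = ∑' j, ∫ ω, (if Q (symbolCount U T j ω) then (1 : ℝ) else 0) ∂μ := by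
  have h := hasSum_integral_of_summable_integral_norm
    (F := fun j ω => if Q (symbolCount U T j ω) then (1 : ℝ) else 0) (μ := μ)
    (fun j => integrable_of_bounded (C := 1)
      (measurable_comp_symbolCount hT hU j fun c => if Q c then (1 : ℝ) else 0)
      fun ω => by split_ifs <;> simp) (hsum.congr fun j => by
        congr 1; ext ω; split_ifs <;> simp)
  rw [h.tsum_eq]
  congr 1
  ext ω
  have hfin : {j : ℕ+ | Q (symbolCount U T j ω)} ⊆ occupied (T ω) fun i => U i ω := by
    intro j hj
    by_contra hj'
    have := (symbolCount_eq_zero_iff U T j ω).2 hj'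
    rw [Set.mem_ofPred_eq, this] at hj
    exact hQ hj
  have hset : {j : ℕ+ | Q (symbolCount U T j ω)}
      = ((occupied (T ω) fun i => U i ω).filter fun j => Q (symbolCount U T j ω) : Finset ℕ+) := by
    ext j
    simp only [Finset.coe_filter, Set.mem_ofPred_eq]
    exact ⟨fun hj => ⟨hfin hj, hj⟩, fun hj => hj.2⟩
  rw [hset, Set.ncard_coe_finset, tsum_eq_sum (s := occupied (T ω) fun i => U i ω)]
  · rw [Finset.card_filter]; simp
  · intro j hj
    rw [if_neg]
    exact fun h => hj (hfin h)

/-- The count of `j` equals two with probability `(n p_j)² exp (-n p_j) / 2`. The case `n = 0` must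
be excluded: the left side is then `0` by division by zero, while the right side is `∑ p_j² > 0`. -/
theorem varianceFactorLeft_eq {N : ℕ → Ω → ℕ} (hU : IsSample μ p U) {n : ℕ} (hn : 1 ≤ n)
    (hN : IsPoissonSize μ U (N n) n) :
    varianceFactorLeft μ U N n = squareLaplace p n := by
  have h1 := fun j => hN.integral_symbolCount_eq hU j 2
  have h2 : ∀ j, ∫ ω, (if symbolCount U (N n) j ω = 2 then (1 : ℝ) else 0) ∂μ
      = (n ^ 2 / 2) * ((p j).toReal ^ 2 * Real.exp (-(n * (p j).toReal))) := by
    intro j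
    rw [h1]
    simp [Nat.factorial]
    ring
  have h3 := integral_ncard_symbolCount hN.measurable hU (Q := fun c => c = 2) (by norm_num)
    (by simp_rw [h2]; exact (summable_squareLaplace p n.cast_nonneg).mul_left _)
  simp_rw [h2] at h3
  rw [tsum_mul_left] at h3
  have hn' : (n : ℝ) ≠ 0 := by positivity
  rw [varianceFactorLeft]
  simp only [occupancyCount]
  rw [h3, squareLaplace]
  field_simp

theorem varianceFactorRight_eq {N : ℕ → Ω → ℕ} (hU : IsSample μ p U) {n : ℕ}
    (hN : IsPoissonSize μ U (N n) n) :
    varianceFactorRight μ U N n = 2 * repeatSum p n / n ^ 2 := by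
  have h2 : ∀ j, ∫ ω, (if 2 ≤ symbolCount U (N n) j ω then (1 : ℝ) else 0) ∂μ
      = 1 - Real.exp (-(n * (p j).toReal)) * (1 + n * (p j).toReal) := by
    intro j
    have hint : ∀ k, Integrable
        (fun ω => if symbolCount U (N n) j ω = k then (1 : ℝ) else 0) μ := fun k =>
      integrable_of_bounded (C := 1)
        (measurable_comp_symbolCount hN.measurable hU j fun c => if c = k then (1 : ℝ) else 0)
        fun ω => by split_ifs <;> simp
    have h : ∀ ω, (if 2 ≤ symbolCount U (N n) j ω then (1 : ℝ) else 0)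
        = 1 - (if symbolCount U (N n) j ω = 0 then (1 : ℝ) else 0)
          - (if symbolCount U (N n) j ω = 1 then (1 : ℝ) else 0) := by
      intro ω
      rcases symbolCount U (N n) j ω with _ | _ | c <;> simp
    simp_rw [h]
    rw [integral_sub ((integrable_const (1 : ℝ)).sub' (hint 0)) (hint 1),
      integral_sub (integrable_const _) (hint 0),
      hN.integral_symbolCount_eq hU, hN.integral_symbolCount_eq hU]
    simp
    ring
  have h3 := integral_ncard_symbolCount hN.measurable hU (Q := fun c => 2 ≤ c) (by norm_num)
    (by simp_rw [h2]; exact summable_repeatSum p n.cast_nonneg)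
  simp_rw [h2] at h3
  rw [varianceFactorRight]
  simp only [cumulatedOccupancyCount]
  rw [h3, repeatSum]

end UrnScheme

namespace UrnScheme

variable {Ω : Type*} [MeasurableSpace Ω] {μ : Measure Ω} {p : PMF ℕ+} {U : ℕ → Ω → ℕ+}
  {T : Ω → ℕ} [IsProbabilityMeasure μ]

/-! ### Concentration of the missing mass -/

theorem integrable_missingMass (hT : Measurable T) (hU : IsSample μ p U) :
    Integrable (missingMass p U T) μ :=
  integrable_of_bounded (C := 1) (measurable_missingMass hT hU) fun ω => by
    rw [abs_of_nonneg (missingMass_nonneg p U T ω)]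
    exact missingMass_le_one p U T ω

theorem hasSum_integral_missingMass (hT : Measurable T) (hU : IsSample μ p U) {q : ℕ+ → ℝ}
    (hq : ∀ j, ∫ ω, (if j ∉ occupied (T ω) (fun i => U i ω) then (1 : ℝ) else 0) ∂μ = q j) :
    HasSum (fun j => (p j).toReal * q j) (∫ ω, missingMass p U T ω ∂μ) := by
  have hint : ∀ j, Integrable (fun ω => (p j).toReal *
      if j ∉ occupied (T ω) (fun i => U i ω) then (1 : ℝ) else 0) μ := fun j =>
    (integrable_of_bounded (C := 1) (measurable_comp_occupied hT hU
      fun S => if j ∉ S then (1 : ℝ) else 0) fun ω => by split_ifs <;> simp).const_mul _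
  have h := hasSum_integral_of_summable_integral_norm hint
    ((summable_toReal p).of_nonneg_of_le (fun j => integral_nonneg fun ω => norm_nonneg _)
      fun j => by
        refine (integral_mono (hint j).norm (integrable_const (p j).toReal) fun ω => ?_).trans
          (by simp)
        simp only [norm_mul, Real.norm_of_nonneg ENNReal.toReal_nonneg]
        exact mul_le_of_le_one_right ENNReal.toReal_nonneg (by split_ifs <;> simp))
  simp_rw [integral_const_mul, hq, (hasSum_missingMass p U T _).tsum_eq] at h
  exact h

theorem unoccupiedProd_exp (p : PMF ℕ+) (s : ℝ) (J S : Finset ℕ+) :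
    unoccupiedProd (fun j => Real.exp (s * (p j).toReal)) J S
      = Real.exp (s * ∑ j ∈ J, (p j).toReal * if j ∉ S then 1 else 0) := by
  rw [Finset.mul_sum, Real.exp_sum]
  exact Finset.prod_congr rfl fun j _ => by by_cases h : j ∈ S <;> simp [h]

/-- An upper bound for the log-Laplace transform of the missing mass, from product bounds for
finitely many symbols. -/
theorem log_laplace_missingMass_le (hT : Measurable T) (hU : IsSample μ p U) {q : ℕ+ → ℝ}
    (hq : ∀ j, ∫ ω, (if j ∉ occupied (T ω) (fun i => U i ω) then (1 : ℝ) else 0) ∂μ = q j)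
    {s : ℝ} (hprod : ∀ J : Finset ℕ+,
      ∫ ω, unoccupiedProd (fun j => Real.exp (s * (p j).toReal)) J
          (occupied (T ω) fun i => U i ω) ∂μ
        ≤ ∏ j ∈ J, (1 + (Real.exp (s * (p j).toReal) - 1) * q j))
    (hq0 : ∀ j, 0 ≤ q j) (hq1 : ∀ j, q j ≤ 1) {V : ℝ}
    (hV : ∀ J : Finset ℕ+,
      ∑ j ∈ J, q j * (Real.exp (s * (p j).toReal) - 1 - s * (p j).toReal) ≤ V) :
    Integrable (fun ω => Real.exp
        (s * (missingMass p U T ω - ∫ ω', missingMass p U T ω' ∂μ))) μ ∧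
      Real.log (∫ ω, Real.exp
        (s * (missingMass p U T ω - ∫ ω', missingMass p U T ω' ∂μ)) ∂μ) ≤ V := by
  have hmean := hasSum_integral_missingMass hT hU hq
  set m := ∫ ω', missingMass p U T ω' ∂μ
  let Y : ℕ+ → Ω → ℝ := fun j ω => if j ∉ occupied (T ω) (fun i => U i ω) then 1 else 0
  have hY0 : ∀ j ω, 0 ≤ Y j ω := fun j ω => by simp only [Y]; split_ifs <;> simp
  have hY1 : ∀ j ω, Y j ω ≤ 1 := fun j ω => by simp only [Y]; split_ifs <;> simp
  have hmeasY : ∀ j, Measurable (Y j) := fun j =>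
    measurable_comp_occupied hT hU fun S => if j ∉ S then (1 : ℝ) else 0
  -- `Z J` is the centred exponent restricted to the symbols of `J`. It is bounded by `|s|`
  -- uniformly in `J`, so bounds for finite `J` pass to the limit by dominated convergence.
  let Z : Finset ℕ+ → Ω → ℝ := fun J ω => s * ∑ j ∈ J, (p j).toReal * (Y j ω - q j)
  have hZb : ∀ J ω, |Z J ω| ≤ |s| := by
    intro J ω
    rw [abs_mul]
    refine mul_le_of_le_one_right (abs_nonneg s) ?_
    calc |∑ j ∈ J, (p j).toReal * (Y j ω - q j)|
        ≤ ∑ j ∈ J, |(p j).toReal * (Y j ω - q j)| := Finset.abs_sum_le_sum_abs _ _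
      _ ≤ ∑ j ∈ J, (p j).toReal := by
          refine Finset.sum_le_sum fun j _ => ?_
          rw [abs_mul, abs_of_nonneg ENNReal.toReal_nonneg]
          refine mul_le_of_le_one_right ENNReal.toReal_nonneg (abs_le.2 ⟨?_, ?_⟩)
          · linarith [hY0 j ω, hq1 j]
          · linarith [hY1 j ω, hq0 j]
      _ ≤ ∑' j, (p j).toReal := (summable_toReal p).sum_le_tsum _ fun _ _ => ENNReal.toReal_nonneg
      _ = 1 := tsum_toReal p
  have hmeasZ : ∀ J, Measurable fun ω => Real.exp (Z J ω) := fun J => by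
    have := hmeasY
    simp only [Z]
    fun_prop
  have hint : Integrable (fun ω => Real.exp (s * (missingMass p U T ω - m))) μ := by
    have hm0 : 0 ≤ m := integral_nonneg fun ω => missingMass_nonneg p U T ω
    have hm1 : m ≤ 1 := by
      rw [← tsum_toReal p]
      exact hasSum_le (fun j => mul_le_of_le_one_right ENNReal.toReal_nonneg (hq1 j)) hmean
        (summable_toReal p).hasSum
    refine integrable_of_bounded (C := Real.exp |s|)
      (((measurable_missingMass hT hU).sub_const m).const_mul s).exp fun ω => ?_
    rw [Real.abs_exp]
    refine Real.exp_le_exp.2 ((le_abs_self _).trans ?_)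
    rw [abs_mul]
    refine mul_le_of_le_one_right (abs_nonneg s) (abs_le.2 ⟨?_, ?_⟩)
    · linarith [missingMass_nonneg p U T ω]
    · linarith [missingMass_le_one p U T ω]
  refine ⟨hint, ?_⟩
  have hlim : Tendsto (fun J => ∫ ω, Real.exp (Z J ω) ∂μ) atTop
      (𝓝 (∫ ω, Real.exp (s * (missingMass p U T ω - m)) ∂μ)) := by
    refine tendsto_integral_filter_of_dominated_convergence (fun _ => Real.exp |s|)
      (Eventually.of_forall fun J => (hmeasZ J).aestronglyMeasurable)
      (Eventually.of_forall fun J => ae_of_all _ fun ω => ?_) (integrable_const _)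
      (ae_of_all _ fun ω => ?_)
    · rw [Real.norm_eq_abs, Real.abs_exp]
      exact Real.exp_le_exp.2 ((le_abs_self _).trans (hZb J ω))
    · have h : HasSum (fun j => (p j).toReal * (Y j ω - q j)) (missingMass p U T ω - m) := by
        simp_rw [mul_sub]
        exact (hasSum_missingMass p U T ω).sub hmean
      rw [HasSum, SummationFilter.unconditional_filter] at h
      exact (Real.continuous_exp.tendsto _).comp (h.const_mul s)
  have hbound : ∀ J, ∫ ω, Real.exp (Z J ω) ∂μ ≤ Real.exp V := by
    intro J
    have h1 : ∀ ω, Real.exp (Z J ω) = Real.exp (-(s * ∑ j ∈ J, (p j).toReal * q j)) *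
        unoccupiedProd (fun j => Real.exp (s * (p j).toReal)) J
          (occupied (T ω) fun i => U i ω) := by
      intro ω
      rw [unoccupiedProd_exp, ← Real.exp_add]
      congr 1
      simp only [Z, Y, mul_sub, Finset.sum_sub_distrib]
      ring
    simp_rw [h1]
    rw [integral_const_mul]
    calc Real.exp (-(s * ∑ j ∈ J, (p j).toReal * q j)) * _
        ≤ Real.exp (-(s * ∑ j ∈ J, (p j).toReal * q j)) *
            ∏ j ∈ J, (1 + (Real.exp (s * (p j).toReal) - 1) * q j) := by
          gcongr
          exact hprod J
      _ ≤ Real.exp (-(s * ∑ j ∈ J, (p j).toReal * q j)) *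
            ∏ j ∈ J, Real.exp ((Real.exp (s * (p j).toReal) - 1) * q j) := by
          gcongr with j _
          · intro j _
            have := mul_nonneg (Real.exp_pos (s * (p j).toReal)).le (hq0 j)
            linarith [hq1 j]
          · rw [add_comm]
            exact Real.add_one_le_exp _
      _ = Real.exp (∑ j ∈ J, q j * (Real.exp (s * (p j).toReal) - 1 - s * (p j).toReal)) := by
          rw [← Real.exp_sum, ← Real.exp_add, Finset.mul_sum, ← Finset.sum_neg_distrib,
            ← Finset.sum_add_distrib]
          congr 1
          exact Finset.sum_congr rfl fun j _ => by ring
      _ ≤ Real.exp V := Real.exp_le_exp.2 (hV J)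
  rw [Real.log_le_iff_le_exp (integral_exp_pos hint)]
  exact le_of_tendsto' hlim hbound

/-- Concentration of the missing mass when the occupancy indicators satisfy the product bounds of
negative association, and no symbol is more likely to be missed than in the Poisson scheme. -/
theorem concentration_missingMass (hT : Measurable T) (hU : IsSample μ p U) {q : ℕ+ → ℝ}
    (hq : ∀ j, ∫ ω, (if j ∉ occupied (T ω) (fun i => U i ω) then (1 : ℝ) else 0) ∂μ = q j)
    (hprod : ∀ (b : ℕ+ → ℝ), (∀ j, 0 ≤ b j) → ((∀ j, b j ≤ 1) ∨ ∀ j, 1 ≤ b j) →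
      ∀ J : Finset ℕ+, ∫ ω, unoccupiedProd b J (occupied (T ω) fun i => U i ω) ∂μ
        ≤ ∏ j ∈ J, (1 + (b j - 1) * q j))
    {n : ℕ} (hn : 1 ≤ n) (hq0 : ∀ j, 0 ≤ q j)
    (hqn : ∀ j, q j ≤ Real.exp (-(n * (p j).toReal))) :
    SubGaussianLeft (missingMass p U T) (squareLaplace p n) μ ∧
      SubGammaRight (missingMass p U T) (2 * repeatSum p n / n ^ 2) (1 / n) μ := by
  have hn0 : (0 : ℝ) < n := by exact_mod_cast hn
  have hq1 : ∀ j, q j ≤ 1 := fun j => (hqn j).trans (Real.exp_le_one_iff.2 (by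
    have : 0 ≤ n * (p j).toReal := by positivity
    linarith))
  refine ⟨⟨integrable_missingMass hT hU, fun s hs => ?_⟩,
    ⟨integrable_missingMass hT hU, fun s hs hsn => ?_⟩⟩
  · refine log_laplace_missingMass_le hT hU hq (hprod _ (fun j => (Real.exp_pos _).le)
      (Or.inl fun j => Real.exp_le_one_iff.2
        (mul_nonpos_of_nonpos_of_nonneg hs ENNReal.toReal_nonneg))) hq0 hq1 fun J => ?_
    calc ∑ j ∈ J, q j * (Real.exp (s * (p j).toReal) - 1 - s * (p j).toReal)
        ≤ ∑ j ∈ J, s ^ 2 / 2 * ((p j).toReal ^ 2 * Real.exp (-(n * (p j).toReal))) := by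
          refine Finset.sum_le_sum fun j _ => ?_
          have h1 := exp_le_quadratic_of_nonpos
            (mul_nonpos_of_nonpos_of_nonneg hs (ENNReal.toReal_nonneg (a := p j)))
          calc q j * (Real.exp (s * (p j).toReal) - 1 - s * (p j).toReal)
              ≤ q j * ((s * (p j).toReal) ^ 2 / 2) :=
                mul_le_mul_of_nonneg_left (by linarith) (hq0 j)
            _ ≤ Real.exp (-(n * (p j).toReal)) * ((s * (p j).toReal) ^ 2 / 2) := by
                gcongr
                exact hqn j
            _ = _ := by ring
      _ ≤ s ^ 2 / 2 * squareLaplace p n := by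
          rw [← Finset.mul_sum]
          gcongr
          exact (summable_squareLaplace p hn0.le).sum_le_tsum _ fun _ _ => by positivity
      _ = _ := by ring
  · rw [one_div_one_div] at hsn
    refine log_laplace_missingMass_le hT hU hq (hprod _ (fun j => (Real.exp_pos _).le)
      (Or.inr fun j => Real.one_le_exp (by positivity))) hq0 hq1 fun J => ?_
    have ht1 : s / n < 1 := (div_lt_one hn0).2 hsn
    have hR : 0 ≤ repeatSum p n := tsum_nonneg fun _ => one_sub_exp_neg_mul_nonneg
    calc ∑ j ∈ J, q j * (Real.exp (s * (p j).toReal) - 1 - s * (p j).toReal)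
        ≤ ∑ j ∈ J, (s / n) ^ 2 *
            (1 - Real.exp (-(n * (p j).toReal)) * (1 + n * (p j).toReal)) := by
          refine Finset.sum_le_sum fun j _ => ?_
          have hx : 0 ≤ n * (p j).toReal := by positivity
          -- With ratio `s / n` and `x = n p_j`, the factor `exp (-x)` turns `exp x - 1 - x` into
          -- the `j`-th term of `repeatSum p n`.
          have h1 := exp_mul_sub_le (div_nonneg hs hn0.le) ht1.le hx
          have h2 : s / n * (n * (p j).toReal) = s * (p j).toReal := by field_simp
          rw [h2] at h1
          have h3 := Real.add_one_le_exp (s * (p j).toReal)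
          have h4 : Real.exp (-(n * (p j).toReal)) * Real.exp (n * (p j).toReal) = 1 := by
            rw [← Real.exp_add]; simp
          calc q j * (Real.exp (s * (p j).toReal) - 1 - s * (p j).toReal)
              ≤ Real.exp (-(n * (p j).toReal)) *
                  (Real.exp (s * (p j).toReal) - 1 - s * (p j).toReal) :=
                mul_le_mul_of_nonneg_right (hqn j) (by linarith)
            _ ≤ Real.exp (-(n * (p j).toReal)) *
                  ((s / n) ^ 2 * (Real.exp (n * (p j).toReal) - 1 - n * (p j).toReal)) := by
                gcongr
            _ = _ := by linear_combination (s / n) ^ 2 * h4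
      _ ≤ (s / n) ^ 2 * repeatSum p n := by
          rw [← Finset.mul_sum]
          gcongr
          exact (summable_repeatSum p hn0.le).sum_le_tsum _
            fun _ _ => one_sub_exp_neg_mul_nonneg
      -- The bound already holds without the denominator; dividing by `1 - s / n ∈ (0, 1]` only
      -- weakens it to the sub-gamma form.
      _ ≤ (s / n) ^ 2 * repeatSum p n / (1 - s / n) :=
          le_div_self (by positivity) (by linarith) (by linarith [div_nonneg hs hn0.le])
      _ = _ := by
          have : 1 - s / n ≠ 0 := by linarith
          have : 1 - 1 / n * s ≠ 0 := by rwa [one_div_mul_eq_div]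
          rw [one_div_mul_eq_div]
          field_simp

theorem IsSample.concentration (hU : IsSample μ p U) {n : ℕ} (hn : 1 ≤ n) :
    SubGaussianLeft (missingMass p U fun _ => n) (squareLaplace p n) μ ∧
      SubGammaRight (missingMass p U fun _ => n) (2 * repeatSum p n / n ^ 2) (1 / n) μ := by
  refine concentration_missingMass measurable_const hU
    (fun j => by simpa using hU.integral_unoccupied {j} n)
    (fun b hb hb1 J => hU.integral_unoccupiedProd_le n hb hb1 J) hn
    (fun j => pow_nonneg (sub_nonneg.2 (toReal_le_one p j)) n) fun j => ?_
  calc (1 - (p j).toReal) ^ n ≤ Real.exp (-(p j).toReal) ^ n :=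
        pow_le_pow_left₀ (sub_nonneg.2 (toReal_le_one p j)) (Real.one_sub_le_exp_neg _) n
    _ = _ := by rw [← Real.exp_nat_mul]; ring_nf

theorem IsPoissonSize.concentration {n : ℕ} (hT : IsPoissonSize μ U T n) (hU : IsSample μ p U)
    (hn : 1 ≤ n) :
    SubGaussianLeft (missingMass p U T) (squareLaplace p n) μ ∧
      SubGammaRight (missingMass p U T) (2 * repeatSum p n / n ^ 2) (1 / n) μ :=
  concentration_missingMass hT.measurable hU
    (fun j => by simpa using hT.integral_unoccupied hU {j})
    (fun b _ _ J => (hT.integral_unoccupiedProd hU b J).le) hn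
    (fun j => (Real.exp_pos _).le) fun j => le_of_eq (by simp)

end UrnScheme

namespace UrnScheme

variable {Ω : Type*} [MeasurableSpace Ω] {μ : Measure Ω} {p : PMF ℕ+} {U : ℕ → Ω → ℕ+}
  {T : Ω → ℕ}

/-! ### Invariance under modification on null sets -/

theorem SubGaussianLeft.congr {Z Z' : Ω → ℝ} {v : ℝ} (h : SubGaussianLeft Z v μ)
    (hZ : Z =ᵐ[μ] Z') : SubGaussianLeft Z' v μ := by
  refine ⟨h.1.congr hZ, fun s hs => ?_⟩
  have he : (fun ω => Real.exp (s * (Z ω - ∫ ω', Z ω' ∂μ)))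
      =ᵐ[μ] fun ω => Real.exp (s * (Z' ω - ∫ ω', Z' ω' ∂μ)) := by
    filter_upwards [hZ] with ω hω
    rw [hω, integral_congr_ae hZ]
  refine ⟨(h.2 s hs).1.congr he, ?_⟩
  rw [← integral_congr_ae he]
  exact (h.2 s hs).2

theorem SubGammaRight.congr {Z Z' : Ω → ℝ} {v c : ℝ} (h : SubGammaRight Z v c μ)
    (hZ : Z =ᵐ[μ] Z') : SubGammaRight Z' v c μ := by
  refine ⟨h.1.congr hZ, fun s hs hsc => ?_⟩
  have he : (fun ω => Real.exp (s * (Z ω - ∫ ω', Z ω' ∂μ)))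
      =ᵐ[μ] fun ω => Real.exp (s * (Z' ω - ∫ ω', Z' ω' ∂μ)) := by
    filter_upwards [hZ] with ω hω
    rw [hω, integral_congr_ae hZ]
  refine ⟨(h.2 s hs hsc).1.congr he, ?_⟩
  rw [← integral_congr_ae he]
  exact (h.2 s hs hsc).2

theorem symbolCount_congr {Ω : Type*} {U U' : ℕ → Ω → ℕ+} {T T' : Ω → ℕ} {ω : Ω} (hU : ∀ i, U i ω = U' i ω)
    (hT : T ω = T' ω) (j : ℕ+) : symbolCount U T j ω = symbolCount U' T' j ω := by
  simp only [symbolCount, hU, hT]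

variable [IsProbabilityMeasure μ]

/-! ### The variance of the missing mass -/

/-- The square of the missing mass is a double series dominated by `p_i p_j`, so it can be
integrated term by term. On the diagonal the squared indicator is itself, whence `q` in place of
`r`. -/
theorem hasSum_variance_missingMass (hT : Measurable T) (hU : IsSample μ p U) {q : ℕ+ → ℝ}
    {r : ℕ+ → ℕ+ → ℝ}
    (hq : ∀ j, ∫ ω, (if j ∉ occupied (T ω) (fun i => U i ω) then (1 : ℝ) else 0) ∂μ = q j)
    (hr : ∀ i j, i ≠ j → ∫ ω, (if ∀ k ∈ ({i, j} : Finset ℕ+), k ∉ occupied (T ω) (fun i => U i ω)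
      then (1 : ℝ) else 0) ∂μ = r i j) :
    HasSum (fun z : ℕ+ × ℕ+ => (p z.1).toReal * (p z.2).toReal *
      ((if z.1 = z.2 then q z.1 else r z.1 z.2) - q z.1 * q z.2))
      (variance (missingMass p U T) μ) := by
  let F : ℕ+ → Ω → ℝ := fun j ω =>
    (p j).toReal * if j ∉ occupied (T ω) (fun i => U i ω) then 1 else 0
  have hF0 : ∀ j ω, 0 ≤ F j ω := fun j ω => by simp only [F]; positivity
  have hF1 : ∀ j ω, F j ω ≤ (p j).toReal := fun j ω =>
    mul_le_of_le_one_right ENNReal.toReal_nonneg (by split_ifs <;> simp)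
  have hFm : ∀ j, Measurable (F j) := fun j =>
    (measurable_comp_occupied hT hU fun S => if j ∉ S then (1 : ℝ) else 0).const_mul _
  have hsummul : Summable fun z : ℕ+ × ℕ+ => (p z.1).toReal * (p z.2).toReal :=
    summable_mul_of_summable_norm (f := fun j => (p j).toReal) (g := fun j => (p j).toReal)
      (summable_toReal p).norm (summable_toReal p).norm
  have hFF : ∀ (z : ℕ+ × ℕ+) ω, |F z.1 ω * F z.2 ω| ≤ (p z.1).toReal * (p z.2).toReal := by
    intro z ω
    rw [abs_of_nonneg (mul_nonneg (hF0 _ _) (hF0 _ _))]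
    exact mul_le_mul (hF1 _ _) (hF1 _ _) (hF0 _ _) ENNReal.toReal_nonneg
  have hint : ∀ z : ℕ+ × ℕ+, Integrable (fun ω => F z.1 ω * F z.2 ω) μ := fun z =>
    integrable_of_bounded ((hFm _).mul (hFm _)) (hFF z)
  have h1 := hasSum_integral_of_summable_integral_norm hint
    (hsummul.of_nonneg_of_le (fun j => integral_nonneg fun ω => norm_nonneg _) fun z =>
      (integral_mono (hint z).norm (integrable_const ((p z.1).toReal * (p z.2).toReal))
        (hFF z)).trans (by simp))
  have hsq : ∀ ω, ∑' z : ℕ+ × ℕ+, F z.1 ω * F z.2 ω = missingMass p U T ω ^ 2 := by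
    intro ω
    have h := hasSum_missingMass p U T ω
    rw [pow_two, ← h.tsum_eq]
    exact (tsum_mul_tsum_of_summable_norm (f := fun j => F j ω) (g := fun j => F j ω)
      h.summable.norm h.summable.norm).symm
  simp_rw [hsq] at h1
  have hmean := hasSum_integral_missingMass hT hU hq
  have h2 := hmean.mul hmean (summable_mul_of_summable_norm (f := fun j => (p j).toReal * q j)
    (g := fun j => (p j).toReal * q j) hmean.summable.norm hmean.summable.norm)
  have h3 := h1.sub h2
  have hLp : MemLp (missingMass p U T) 2 μ :=
    MemLp.of_bound (measurable_missingMass hT hU).aestronglyMeasurable 1 (ae_of_all _ fun ω => by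
      rw [Real.norm_of_nonneg (missingMass_nonneg p U T ω)]
      exact missingMass_le_one p U T ω)
  rw [variance_eq_sub hLp, pow_two (∫ ω, missingMass p U T ω ∂μ)]
  refine h3.congr_fun fun z => ?_
  have h4 : ∫ ω, F z.1 ω * F z.2 ω ∂μ
      = (p z.1).toReal * (p z.2).toReal * (if z.1 = z.2 then q z.1 else r z.1 z.2) := by
    have h5 : ∀ ω, F z.1 ω * F z.2 ω = (p z.1).toReal * (p z.2).toReal *
        if ∀ k ∈ ({z.1, z.2} : Finset ℕ+), k ∉ occupied (T ω) (fun i => U i ω)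
          then (1 : ℝ) else 0 := by
      intro ω
      simp only [F, Finset.mem_insert, Finset.mem_singleton, forall_eq_or_imp, forall_eq]
      by_cases ha : z.1 ∈ occupied (T ω) (fun i => U i ω) <;>
        by_cases hb : z.2 ∈ occupied (T ω) (fun i => U i ω) <;> simp [ha, hb]
    simp_rw [h5]
    rw [integral_const_mul]
    congr 1
    split_ifs with h
    · rw [← h, ← hq z.1]
      simp
    · exact hr _ _ h
  rw [h4]
  ring

theorem hasSum_diagonal {f : ℕ+ → ℝ} {s : ℝ} (hf : HasSum f s) :
    HasSum (fun z : ℕ+ × ℕ+ => if z.1 = z.2 then f z.1 else 0) s := by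
  have hinj : Function.Injective fun j : ℕ+ => (j, j) := fun i j h => congrArg Prod.fst h
  refine (hinj.hasSum_iff fun z hz => ?_).1 (by simpa [Function.comp_def] using hf)
  exact if_neg fun h => hz ⟨z.1, Prod.ext rfl h⟩

/-- Off the diagonal the covariances vanish, by independence of the absence indicators. -/
theorem IsPoissonSize.hasSum_variance {n : ℕ} (hT : IsPoissonSize μ U T n)
    (hU : IsSample μ p U) :
    HasSum (fun z : ℕ+ × ℕ+ => if z.1 = z.2 then (p z.1).toReal ^ 2 *
      (Real.exp (-(n * (p z.1).toReal)) - Real.exp (-(n * (p z.1).toReal)) ^ 2) else 0)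
      (variance (missingMass p U T) μ) := by
  refine (hasSum_variance_missingMass hT.measurable hU
    (fun j => by simpa using hT.integral_unoccupied hU {j})
    (fun i j hij => hT.integral_unoccupied hU {i, j})).congr_fun fun z => ?_
  split_ifs with h
  · rw [← h]; ring
  · rw [Finset.prod_pair h]; simp

theorem IsPoissonSize.variance_eq {n : ℕ} (hT : IsPoissonSize μ U T n) (hU : IsSample μ p U) :
    variance (missingMass p U T) μ = squareLaplace p n - squareLaplace p (2 * n) := by
  have h := (summable_squareLaplace p (n.cast_nonneg (α := ℝ))).hasSum.sub
    (summable_squareLaplace p (t := 2 * n) (by positivity)).hasSum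
  refine (hT.hasSum_variance hU).unique ((hasSum_diagonal h).congr_fun fun z => ?_)
  refine if_congr Iff.rfl ?_ rfl
  rw [← Real.exp_nat_mul, mul_sub]
  congr 3
  push_cast
  ring

theorem IsSample.hasSum_variance (hU : IsSample μ p U) (n : ℕ) :
    HasSum (fun z : ℕ+ × ℕ+ => (p z.1).toReal * (p z.2).toReal *
      ((if z.1 = z.2 then (1 - (p z.1).toReal) ^ n
        else (1 - ((p z.1).toReal + (p z.2).toReal)) ^ n)
        - (1 - (p z.1).toReal) ^ n * (1 - (p z.2).toReal) ^ n))
      (variance (missingMass p U fun _ => n) μ) :=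
  hasSum_variance_missingMass (q := fun j => (1 - (p j).toReal) ^ n)
    (r := fun i j => (1 - ((p i).toReal + (p j).toReal)) ^ n) measurable_const hU
    (fun j => by simpa using hU.integral_unoccupied {j} n)
    (fun i j hij => by rw [hU.integral_unoccupied {i, j} n, Finset.sum_pair hij])

theorem pow_sub_pow_le_mul_pow {x y : ℝ} (hy : 0 ≤ y) (hxy : y ≤ x) (n : ℕ) :
    x ^ n - y ^ n ≤ n * (x - y) * x ^ (n - 1) := by
  have h := abs_pow_sub_pow_le x y n
  rw [abs_of_nonneg (sub_nonneg.2 hxy), abs_of_nonneg hy, abs_of_nonneg (hy.trans hxy),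
    max_eq_left hxy] at h
  calc x ^ n - y ^ n ≤ _ := (le_abs_self _).trans h
    _ = _ := by ring

/-- Replacing the exponent `n - 1` by `n` costs a factor `exp a ≤ exp 1`; the constants `Real.exp 1`
in the variance comparison come from here. -/
theorem exp_neg_pow_pred_le {a : ℝ} (ha1 : a ≤ 1) {n : ℕ} (hn : 1 ≤ n) :
    Real.exp (-a) ^ (n - 1) ≤ Real.exp 1 * Real.exp (-(n * a)) := by
  rw [← Real.exp_nat_mul, ← Real.exp_add, Nat.cast_sub hn, Nat.cast_one]
  refine Real.exp_le_exp.2 ?_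
  linarith

/-- Pairs of symbols: the covariance of the occupancy indicators is small. -/
theorem abs_one_sub_add_pow_sub_le {a b : ℝ} (ha : 0 ≤ a) (hb : 0 ≤ b) (hab : a + b ≤ 1)
    {n : ℕ} (hn : 1 ≤ n) :
    |(1 - (a + b)) ^ n - (1 - a) ^ n * (1 - b) ^ n|
      ≤ n * Real.exp 1 ^ 2 * (a * Real.exp (-(n * a))) * (b * Real.exp (-(n * b))) := by
  have h0 : 0 ≤ 1 - (a + b) := by linarith
  have h1 : 1 - (a + b) ≤ (1 - a) * (1 - b) := by nlinarith
  rw [← mul_pow, abs_sub_comm, abs_of_nonneg (sub_nonneg.2 (pow_le_pow_left₀ h0 h1 n))]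
  have ha1 : 1 - a ≤ Real.exp (-a) := Real.one_sub_le_exp_neg a
  have hb1 : 1 - b ≤ Real.exp (-b) := Real.one_sub_le_exp_neg b
  calc ((1 - a) * (1 - b)) ^ n - (1 - (a + b)) ^ n
      ≤ n * ((1 - a) * (1 - b) - (1 - (a + b))) * ((1 - a) * (1 - b)) ^ (n - 1) :=
        pow_sub_pow_le_mul_pow h0 h1 n
    _ = n * (a * b) * ((1 - a) ^ (n - 1) * (1 - b) ^ (n - 1)) := by rw [mul_pow]; ring
    _ ≤ n * (a * b) * ((Real.exp 1 * Real.exp (-(n * a))) *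
          (Real.exp 1 * Real.exp (-(n * b)))) := by
        gcongr
        · exact pow_nonneg (by linarith) _
        · exact (pow_le_pow_left₀ (by linarith) ha1 _).trans (exp_neg_pow_pred_le (by linarith) hn)
        · exact (pow_le_pow_left₀ (by linarith) hb1 _).trans (exp_neg_pow_pred_le (by linarith) hn)
    _ = _ := by ring

/-- Single symbols: the variances of the occupancy indicators in the two schemes are close. -/
theorem abs_pow_sub_sq_sub_le {a : ℝ} (ha : 0 ≤ a) (ha1 : a ≤ 1) {n : ℕ} (hn : 1 ≤ n) :
    |((1 - a) ^ n - (1 - a) ^ n * (1 - a) ^ n) - (Real.exp (-(n * a)) - Real.exp (-(n * a)) ^ 2)|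
      ≤ 2 * Real.exp 1 * n * a ^ 2 * Real.exp (-(n * a)) := by
  have h0 : 0 ≤ 1 - a := by linarith
  have h1 : 1 - a ≤ Real.exp (-a) := Real.one_sub_le_exp_neg a
  have h2 := exp_le_quadratic_of_nonpos (neg_nonpos.2 ha)
  set E := Real.exp (-(n * a))
  have hE : Real.exp (-a) ^ n = E := by rw [← Real.exp_nat_mul]; simp [E]
  have hqE : (1 - a) ^ n ≤ E := hE ▸ pow_le_pow_left₀ h0 h1 n
  have hq0 : 0 ≤ (1 - a) ^ n := pow_nonneg h0 n
  have hE1 : E ≤ 1 := Real.exp_le_one_iff.2 (by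
    have : 0 ≤ n * a := by positivity
    linarith)
  -- The bases differ by `exp (-a) - (1 - a) ≤ a² / 2`.
  have h3 : E - (1 - a) ^ n ≤ n * (a ^ 2 / 2) * (Real.exp 1 * E) := by
    rw [← hE]
    refine (pow_sub_pow_le_mul_pow h0 h1 n).trans ?_
    rw [hE]
    gcongr
    · linarith
    · exact exp_neg_pow_pred_le ha1 hn
  -- Both arguments lie in `[0, 1]`, where `x ↦ x - x²` is `1`-Lipschitz; the constant `3` is
  -- generous.
  have h4 : |((1 - a) ^ n - (1 - a) ^ n * (1 - a) ^ n) - (E - E ^ 2)|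
      ≤ 3 * (E - (1 - a) ^ n) := by
    rw [abs_le]
    constructor <;> nlinarith
  have h5 : 0 ≤ n * (a ^ 2) * (Real.exp 1 * E) := by positivity
  linarith

theorem add_toReal_le_one (p : PMF ℕ+) {i j : ℕ+} (hij : i ≠ j) :
    (p i).toReal + (p j).toReal ≤ 1 := by
  rw [← tsum_toReal p, ← Finset.sum_pair (f := fun j => (p j).toReal) hij]
  exact (summable_toReal p).sum_le_tsum _ fun _ _ => ENNReal.toReal_nonneg

/-- Off the diagonal only the binomial covariances survive; they are small enough to sum to a
multiple of `n (L n)²`. On the diagonal the error is of order `n p_j⁴ exp (-n p_j) = n⁻³ (n p_j)⁴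
exp (-n p_j)`, which is controlled by the terms of `repeatSum`. -/
theorem abs_variance_sub_variance_le {n : ℕ} (hn : 1 ≤ n) (hT : IsPoissonSize μ U T n)
    (hU : IsSample μ p U) :
    |variance (missingMass p U fun _ => n) μ - variance (missingMass p U T) μ|
      ≤ n * Real.exp 1 ^ 2 * squareLaplace p n ^ 2
        + 48 * Real.exp 1 / n ^ 3 * repeatSum p n := by
  have hn0 : (0 : ℝ) < n := by exact_mod_cast hn
  have hL := (summable_squareLaplace p (n.cast_nonneg (α := ℝ)))
  let f : ℕ+ → ℝ := fun j => (p j).toReal ^ 2 * Real.exp (-(n * (p j).toReal))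
  -- This majorant runs over all pairs; its diagonal terms are superfluous but nonnegative.
  have h1 := (hL.hasSum.mul hL.hasSum
    (summable_mul_of_summable_norm (f := f) (g := f) hL.norm hL.norm)).mul_left
    (n * Real.exp 1 ^ 2)
  have h2 := hasSum_diagonal ((summable_repeatSum p (n.cast_nonneg (α := ℝ))).hasSum.mul_left
    (48 * Real.exp 1 / n ^ 3))
  have h3 := h1.add h2
  have h4 := (hU.hasSum_variance n).sub (hT.hasSum_variance hU)
  rw [← h4.tsum_eq, pow_two (squareLaplace p n)]
  refine (Real.norm_eq_abs _ ▸ tsum_of_norm_bounded h3 fun z => ?_)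
  have ha : 0 ≤ (p z.1).toReal := ENNReal.toReal_nonneg
  have hb : 0 ≤ (p z.2).toReal := ENNReal.toReal_nonneg
  rw [Real.norm_eq_abs]
  by_cases h : z.1 = z.2
  · simp only [if_pos h]
    rw [← h, ← pow_two, ← mul_sub, abs_mul, abs_of_nonneg (by positivity : 0 ≤ (p z.1).toReal ^ 2)]
    have h5 := abs_pow_sub_sq_sub_le ha (toReal_le_one p z.1) hn
    have h6 := pow_four_mul_exp_neg_le (x := n * (p z.1).toReal) (by positivity)
    set a := (p z.1).toReal
    calc a ^ 2 * _ ≤ a ^ 2 * (2 * Real.exp 1 * n * a ^ 2 * Real.exp (-(n * a))) := by gcongr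
      _ = 2 * Real.exp 1 / n ^ 3 * ((n * a) ^ 4 * Real.exp (-(n * a))) := by field_simp
      _ ≤ 2 * Real.exp 1 / n ^ 3 * (24 * (1 - Real.exp (-(n * a)) * (1 + n * a))) := by gcongr
      _ = 48 * Real.exp 1 / n ^ 3 * (1 - Real.exp (-(n * a)) * (1 + n * a)) := by ring
      _ ≤ _ := le_add_of_nonneg_left (by positivity)
  · simp only [if_neg h, sub_zero, add_zero]
    have h5 := abs_one_sub_add_pow_sub_le ha hb (add_toReal_le_one p h) hn
    rw [abs_mul, abs_of_nonneg (by positivity : 0 ≤ (p z.1).toReal * (p z.2).toReal)]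
    refine (mul_le_mul_of_nonneg_left h5 (by positivity)).trans_eq ?_
    ring

/-! ### Asymptotic comparison with the variance -/

section Asymptotics

variable {α : ℝ}

theorem one_sub_two_rpow_pos (hα1 : α ≤ 1) : 0 < 1 - (2 : ℝ) ^ (α - 2) :=
  sub_pos.2 (Real.rpow_lt_one_of_one_lt_of_neg one_lt_two (by linarith))

theorem tendsto_variance_poisson_div (hα0 : 0 < α) (hα1 : α ≤ 1)
    (hreg : RegularlyVarying (fun x : ℝ => countingFunction p (1 / x)) α)
    (hU : IsSample μ p U) {N : ℕ → Ω → ℕ} (hN : ∀ n : ℕ, IsPoissonSize μ U (N n) n) :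
    Tendsto (fun n : ℕ => variance (missingMass p U (N n)) μ / squareLaplace p n) atTop
      (𝓝 (1 - (2 : ℝ) ^ (α - 2))) := by
  refine (((tendsto_squareLaplace_two_mul_div p hα0 hα1 hreg).comp
    tendsto_natCast_atTop_atTop).const_sub 1).congr fun n => ?_
  have := (squareLaplace_pos p (n.cast_nonneg (α := ℝ))).ne'
  simp only [Function.comp]
  rw [(hN n).variance_eq hU, sub_div, div_self this]

/-- Divided by `L n`, the first error term is a multiple of `n L n → 0`. The second is `24 e / n`
times `(2 R n / n²) / L n`, and that quotient converges to `2 / α`. -/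
theorem tendsto_variance_binomial_div (hα0 : 0 < α) (hα1 : α ≤ 1)
    (hreg : RegularlyVarying (fun x : ℝ => countingFunction p (1 / x)) α)
    (hU : IsSample μ p U) {N : ℕ → Ω → ℕ} (hN : ∀ n : ℕ, IsPoissonSize μ U (N n) n) :
    Tendsto (fun n : ℕ => variance (missingMass p U fun _ => n) μ / squareLaplace p n) atTop
      (𝓝 (1 - (2 : ℝ) ^ (α - 2))) := by
  have hcast := tendsto_natCast_atTop_atTop (R := ℝ)
  have h1 := ((tendsto_mul_squareLaplace p).comp hcast).const_mul (Real.exp 1 ^ 2)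
  have h2 := ((tendsto_squareLaplace_div_repeatSum p hα1 hreg).inv₀ (by positivity)).comp hcast
  have h3 := (h2.mul (tendsto_inv_atTop_zero.comp hcast)).const_mul (24 * Real.exp 1)
  have h4 := h1.add h3
  simp only [mul_zero, add_zero] at h4
  have h5 : Tendsto (fun n : ℕ => (variance (missingMass p U fun _ => n) μ
      - variance (missingMass p U (N n)) μ) / squareLaplace p n) atTop (𝓝 0) := by
    refine squeeze_zero_norm' ?_ h4
    filter_upwards [eventually_ge_atTop 1] with n hn
    have hL := squareLaplace_pos p (n.cast_nonneg (α := ℝ))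
    have hn0 : (0 : ℝ) < n := by exact_mod_cast hn
    rw [norm_div, Real.norm_eq_abs, Real.norm_of_nonneg hL.le, div_le_iff₀ hL]
    refine (abs_variance_sub_variance_le hn (hN n) hU).trans_eq ?_
    simp only [Function.comp, inv_div]
    field_simp
    ring
  have h6 := (tendsto_variance_poisson_div hα0 hα1 hreg hU hN).add h5
  rw [add_zero] at h6
  refine h6.congr fun n => ?_
  rw [← add_div]
  ring

/-- Limits of the ratios of the variance factors to a variance. -/
theorem tendsto_varianceFactor_div {v : ℕ → ℝ} (hα0 : 0 < α) (hα1 : α ≤ 1)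
    (hreg : RegularlyVarying (fun x : ℝ => countingFunction p (1 / x)) α)
    (hv : Tendsto (fun n : ℕ => v n / squareLaplace p n) atTop (𝓝 (1 - (2 : ℝ) ^ (α - 2)))) :
    Tendsto (fun n : ℕ => squareLaplace p n / v n) atTop (𝓝 (1 / (1 - (2 : ℝ) ^ (α - 2)))) ∧
      Tendsto (fun n : ℕ => 2 * repeatSum p n / n ^ 2 / v n) atTop
        (𝓝 (2 / (α * (1 - (2 : ℝ) ^ (α - 2))))) := by
  have hc := one_sub_two_rpow_pos hα1
  have h1 := hv.inv₀ hc.ne'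
  simp_rw [inv_div] at h1
  rw [← one_div] at h1
  refine ⟨h1, ?_⟩
  have h2 := ((tendsto_squareLaplace_div_repeatSum p hα1 hreg).inv₀ (by positivity)).comp
    (tendsto_natCast_atTop_atTop (R := ℝ))
  have h3 := h2.mul h1
  convert! h3.congr fun n => ?_ using 2
  · field_simp
  · have := (squareLaplace_pos p (n.cast_nonneg (α := ℝ))).ne'
    simp only [Function.comp, inv_div]
    rw [div_mul_div_cancel₀ this]

end Asymptotics

end UrnScheme

/-! ### The main theorem -/

theorem mainTheorem4 {Ω : Type*} [MeasurableSpace Ω] (μ : Measure Ω) [IsProbabilityMeasure μ]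
    (p : PMF ℕ+)
    -- the i.i.d. draws with distribution `p`
    (U : ℕ → Ω → ℕ+) (hUlaw : ∀ i, HasLaw (U i) p.toMeasure μ) (hUindep : iIndepFun U μ)
    -- the Poisson sample sizes: `N n` has mean `n` and is independent of the draws
    (N : ℕ → Ω → ℕ) (hNlaw : ∀ n : ℕ, HasLaw (N n) (poissonMeasure (n : ℝ≥0)) μ)
    (hNindep : ∀ n : ℕ, IndepFun (N n) (fun ω i => U i ω) μ)
    (α : ℝ) (hα0 : 0 < α) (hα1 : α ≤ 1)
    (hreg : UrnScheme.RegularlyVarying (fun x : ℝ => UrnScheme.countingFunction p (1 / x)) α) :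
    -- concentration, binomial setting
    (∀ n : ℕ, 1 ≤ n →
      UrnScheme.SubGaussianLeft (UrnScheme.missingMass p U (fun _ => n))
        (UrnScheme.varianceFactorLeft μ U N n) μ ∧
      UrnScheme.SubGammaRight (UrnScheme.missingMass p U (fun _ => n))
        (UrnScheme.varianceFactorRight μ U N n) (1 / (n : ℝ)) μ) ∧
    -- concentration, Poisson setting
    (∀ n : ℕ, 1 ≤ n →
      UrnScheme.SubGaussianLeft (UrnScheme.missingMass p U (N n))
        (UrnScheme.varianceFactorLeft μ U N n) μ ∧
      UrnScheme.SubGammaRight (UrnScheme.missingMass p U (N n))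
        (UrnScheme.varianceFactorRight μ U N n) (1 / (n : ℝ)) μ) ∧
    -- comparison with the variance, binomial setting
    Tendsto (fun n : ℕ => UrnScheme.varianceFactorLeft μ U N n /
        variance (UrnScheme.missingMass p U (fun _ => n)) μ) atTop
      (𝓝 (1 / (1 - (2 : ℝ) ^ (α - 2)))) ∧
    Tendsto (fun n : ℕ => UrnScheme.varianceFactorRight μ U N n /
        variance (UrnScheme.missingMass p U (fun _ => n)) μ) atTop
      (𝓝 (2 / (α * (1 - (2 : ℝ) ^ (α - 2))))) ∧
    -- comparison with the variance, Poisson setting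
    Tendsto (fun n : ℕ => UrnScheme.varianceFactorLeft μ U N n /
        variance (UrnScheme.missingMass p U (N n)) μ) atTop
      (𝓝 (1 / (1 - (2 : ℝ) ^ (α - 2)))) ∧
    Tendsto (fun n : ℕ => UrnScheme.varianceFactorRight μ U N n /
        variance (UrnScheme.missingMass p U (N n)) μ) atTop
      (𝓝 (2 / (α * (1 - (2 : ℝ) ^ (α - 2))))) ∧
    -- comparison of the two variance factors
    Tendsto (fun n : ℕ => UrnScheme.varianceFactorLeft μ U N n /
        UrnScheme.varianceFactorRight μ U N n) atTop (𝓝 (α / 2)) := by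
  -- `HasLaw` gives only almost-everywhere measurability. The argument runs on measurable versions
  -- `U'` and `N'`; every quantity in the conclusion is unaffected by changes on a null set.
  choose U' hU'm hU'ae using fun i => (hUlaw i).aemeasurable
  choose N' hN'm hN'ae using fun n => (hNlaw n).aemeasurable
  have hUae : ∀ᵐ ω ∂μ, ∀ i, U i ω = U' i ω := ae_all_iff.2 hU'ae
  have hU : UrnScheme.IsSample μ p U' :=
    ⟨hU'm, fun i => by rw [← Measure.map_congr (hU'ae i), (hUlaw i).map_eq],
      hUindep.congr hU'ae⟩
  have hN : ∀ n : ℕ, UrnScheme.IsPoissonSize μ U' (N' n) n := fun n =>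
    ⟨hN'm n, by rw [← Measure.map_congr (hN'ae n), (hNlaw n).map_eq],
      (hNindep n).congr (hN'ae n) (hUae.mono fun ω h => funext h)⟩
  have hMb : ∀ n : ℕ, UrnScheme.missingMass p U' (fun _ => n)
      =ᵐ[μ] UrnScheme.missingMass p U (fun _ => n) := fun n => by
    filter_upwards [hUae] with ω hω
    simp only [UrnScheme.missingMass,
      UrnScheme.symbolCount_congr (T := fun _ => n) (T' := fun _ => n) hω rfl]
  have hMp : ∀ n : ℕ, UrnScheme.missingMass p U' (N' n)
      =ᵐ[μ] UrnScheme.missingMass p U (N n) := fun n => by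
    filter_upwards [hUae, hN'ae n] with ω hω hω'
    simp only [UrnScheme.missingMass, UrnScheme.symbolCount_congr hω hω']
  have hvl : ∀ n : ℕ, 1 ≤ n →
      UrnScheme.varianceFactorLeft μ U N n = UrnScheme.squareLaplace p n := fun n hn => by
    rw [← UrnScheme.varianceFactorLeft_eq hU hn (hN n), UrnScheme.varianceFactorLeft,
      UrnScheme.varianceFactorLeft]
    congr 2
    refine integral_congr_ae ?_
    filter_upwards [hUae, hN'ae n] with ω hω hω'
    simp only [UrnScheme.occupancyCount, UrnScheme.symbolCount_congr hω hω']
  have hvr : ∀ n : ℕ,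
      UrnScheme.varianceFactorRight μ U N n = 2 * UrnScheme.repeatSum p n / n ^ 2 := fun n => by
    rw [← UrnScheme.varianceFactorRight_eq hU (hN n), UrnScheme.varianceFactorRight,
      UrnScheme.varianceFactorRight]
    congr 2
    refine integral_congr_ae ?_
    filter_upwards [hUae, hN'ae n] with ω hω hω'
    simp only [UrnScheme.cumulatedOccupancyCount, UrnScheme.symbolCount_congr hω hω']
  have hvl' : ∀ᶠ n : ℕ in atTop,
      UrnScheme.squareLaplace p n = UrnScheme.varianceFactorLeft μ U N n :=
    (eventually_ge_atTop 1).mono fun n hn => (hvl n hn).symm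
  obtain ⟨hbl, hbr⟩ := UrnScheme.tendsto_varianceFactor_div hα0 hα1 hreg
    (UrnScheme.tendsto_variance_binomial_div hα0 hα1 hreg hU hN)
  obtain ⟨hpl, hpr⟩ := UrnScheme.tendsto_varianceFactor_div hα0 hα1 hreg
    (UrnScheme.tendsto_variance_poisson_div hα0 hα1 hreg hU hN)
  simp_rw [fun n => variance_congr (hMb n), ← hvr] at hbl hbr
  simp_rw [fun n => variance_congr (hMp n), ← hvr] at hpl hpr
  refine ⟨fun n hn => ?_, fun n hn => ?_, ?_, hbr, ?_, hpr, ?_⟩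
  · rw [hvl n hn, hvr n]
    exact ⟨(hU.concentration hn).1.congr (hMb n), (hU.concentration hn).2.congr (hMb n)⟩
  · rw [hvl n hn, hvr n]
    exact ⟨((hN n).concentration hU hn).1.congr (hMp n),
      ((hN n).concentration hU hn).2.congr (hMp n)⟩
  · exact hbl.congr' (hvl'.mono fun n hn => by rw [hn])
  · exact hpl.congr' (hvl'.mono fun n hn => by rw [hn])
  · have h := (UrnScheme.tendsto_squareLaplace_div_repeatSum p hα1 hreg).comp
      (tendsto_natCast_atTop_atTop (R := ℝ))
    exact h.congr' (hvl'.mono fun n hn => by simp only [Function.comp, hn, hvr])
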